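/- Let $r\ge 1$, let $\boldsymbol\mu=(\mu_1,\dots,\mu_r)$ be finite positive Borel measures on the unit circle $\partial\mathbb D$, each with infinite support, and let $\boldsymbol n=(n_1,\dots,n_r)\in\mathbb N^r$ (entries may be $0$), $|\boldsymbol n|=n_1+\dots+n_r$. For $t_0\in\mathbb R$ put $z^{k/2}=|z|^{k/2}e^{ik\arg(z)/2}$ for $k\in\mathbb Z$, where $\arg z\in[t_0,t_0+2\pi)$. A (monic) type II Laurent multiple orthogonal polynomial for $\boldsymbol n$ is a function $$\phi_{\boldsymbol n}(z)=z^{|\boldsymbol n|/2}+\kappa_{|\boldsymbol n|/2-1}z^{|\boldsymbol n|/2-1}+\dots+\kappa_{-|\boldsymbol n|/2}z^{-|\boldsymbol n|/2}$$ with complex coefficients such that $$\int\phi_{\boldsymbol n}(z)z^{-p}\,d\mu_j(z)=0,\qquad p=-\tfrac{n_j}2,-\tfrac{n_j}2+1,\dots,\tfrac{n_j}2-1,\quad j=1,\dots,r.$$ Assume that one of the following holds. (a) (Angelesco system.) There are closed arcs $\Gamma_j=\{e^{i\theta}:a_j\le\theta\le b_j\}$ with $\operatorname{supp}\mu_j\subseteq\Gamma_j$,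 where $t_0\le a_j<b_j\le t_0+2\pi$ and the intervals $[a_j,b_j]$ do not overlap (for $j\ne k$ they have at most an endpoint in common); moreover, if $b_j=t_0+2\pi$, then $\mu_j$ has no point mass at $e^{it_0}$. (b) (AT system for the index $\boldsymbol n$.) There are $\alpha<\beta\le\alpha+2\pi$, a finite positive measure $\mu$ supported on the arc $\{e^{i\theta}:\alpha\le\theta\le\beta\}$ and real functions $w_j$ such that $d\mu_j(e^{i\theta})=w_j(\theta)\,d\mu(e^{i\theta})$, with $\theta\in[\alpha,\alpha+2\pi)$ and $w_j\ge0$ $\mu$-almost everywhere, and the $|\boldsymbol n|$ functions in $\operatorname{Trig}_{n_1}(w_1),\dots,\operatorname{Trig}_{n_r}(w_r)$ taken together form a Chebyshev system on $[\alpha,\beta]$; and $t_0=\alpha$. Here $\operatorname{Trig}_m(f)$ consists of $f(\theta)\cos\frac{2k-1}2\theta$, $f(\theta)\sin\frac{2k-1}2\theta$ for $k=1,\dots,\frac m2$ if $m$ is even, and of $f(\theta)$ together with $f(\theta)\cos k\theta$, $f(\theta)\sin k\theta$ for $k=1,\dots,\frac{m-1}2$ if $m$ is odd; continuous real functions $u_1,\dots,u_N$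 form a Chebyshev system on $[\alpha,\beta]$ if $\det(u_i(x_k))_{i,k=1}^N\ne0$ for all pairwise different $x_1,\dots,x_N\in[\alpha,\beta]$. Then $\phi_{\boldsymbol n}$ exists and is unique, and the polynomial $z^{|\boldsymbol n|/2}\phi_{\boldsymbol n}(z)$ has exactly $|\boldsymbol n|$ zeros, counted with multiplicity, all of which lie in the open unit disc $\mathbb D=\{z:|z|<1\}$. -/

import Mathlib

open MeasureTheory Polynomial

noncomputable section

namespace LaurentMOPUC

/-- The argument of `z` taken in `[t₀, t₀ + 2π)`. -/
def argFrom (t₀ : ℝ) (z : ℂ) : ℝ := toIcoMod Real.two_pi_pos t₀ (Complex.arg z)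

/-- The half-integer power `z ^ (k / 2) = |z| ^ (k / 2) * exp (i k arg z / 2)`, where the argument
is taken in `[t₀, t₀ + 2π)`. -/
def halfPow (t₀ : ℝ) (k : ℤ) (z : ℂ) : ℂ :=
  ((‖z‖ ^ ((k : ℝ) / 2) : ℝ) : ℂ) * Complex.exp (Complex.I * k * (argFrom t₀ z : ℂ) / 2)

/-- The closed arc `{e^{iθ} : a ≤ θ ≤ b}` of the unit circle. -/
def circleArc (a b : ℝ) : Set ℂ := (fun θ : ℝ => Complex.exp (Complex.I * θ)) '' Set.Icc a b

/-- `|n| = n₁ + ⋯ + n_r`. -/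
def size {r : ℕ} (n : Fin r → ℕ) : ℕ := ∑ j, n j

/-- `φ` is a type II Laurent multiple orthogonal polynomial for the index `n`, with leading
coefficient one: `φ(z) = z^{|n|/2} + κ_{|n|/2-1} z^{|n|/2-1} + ⋯ + κ_{-|n|/2} z^{-|n|/2}`
(here `κ k` is the coefficient of `z^{k-|n|/2}`, `0 ≤ k < |n|`), and `∫ φ(z) z^{-p} dμ_j(z) = 0`
for `p = -n_j/2, -n_j/2 + 1, …, n_j/2 - 1` (here `p = k - n_j/2`, `0 ≤ k < n_j`) and all `j`. -/
def IsMonicTypeII {r : ℕ} (t₀ : ℝ) (μ : Fin r → Measure ℂ) (n : Fin r → ℕ) (φ : ℂ → ℂ) : Prop :=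
  (∃ κ : Fin (size n) → ℂ, ∀ z, φ z = halfPow t₀ (size n) z +
      ∑ k : Fin (size n), κ k * halfPow t₀ (2 * (k : ℤ) - size n) z) ∧
  ∀ (j : Fin r) (k : Fin (n j)), ∫ z, φ z * halfPow t₀ ((n j : ℤ) - 2 * (k : ℤ)) z ∂(μ j) = 0

/-- `φ`-normality of the index `n`: the monic `φ_n` exists and is unique. -/
def IsPhiNormal {r : ℕ} (t₀ : ℝ) (μ : Fin r → Measure ℂ) (n : Fin r → ℕ) : Prop :=
  ∃! φ : ℂ → ℂ, IsMonicTypeII t₀ μ n φ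

/-- Angelesco system on the unit circle, with `t₀` adapted to it: the measures are supported on
closed arcs which meet at most at endpoints; `t₀` is not interior to any arc, so that the arcs are
given by non-overlapping intervals `[a j, b j]` inside `[t₀, t₀ + 2π]`; and the last measure
(the one whose interval reaches `t₀ + 2π`, if there is one) has no point mass at `e^{it₀}`. -/
def IsAngelescoSystem {r : ℕ} (t₀ : ℝ) (μ : Fin r → Measure ℂ) : Prop :=
  ∃ a b : Fin r → ℝ,
    (∀ j, t₀ ≤ a j ∧ a j < b j ∧ b j ≤ t₀ + 2 * Real.pi) ∧
    (∀ j k, j ≠ k → b j ≤ a k ∨ b k ≤ a j) ∧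
    (∀ j, (μ j).support ⊆ circleArc (a j) (b j)) ∧
    (∀ j, b j = t₀ + 2 * Real.pi → μ j {Complex.exp (Complex.I * t₀)} = 0)

/-- A Chebyshev system on `s`: continuous real functions whose determinant at any
pairwise different points of `s` does not vanish. -/
def IsChebyshevSystem {ι : Type} [Fintype ι] [DecidableEq ι] (u : ι → ℝ → ℝ) (s : Set ℝ) : Prop :=
  (∀ i, ContinuousOn (u i) s) ∧
  ∀ x : ι → ℝ, (∀ i, x i ∈ s) → Function.Injective x →
    (Matrix.of fun i k => u i (x k)).det ≠ 0

/-- The family `Trig_m(f)` of `m` functions. For even `m` it consists of `f(θ) cos((2i+1)θ/2)` (at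
`k = 2i`) and `f(θ) sin((2i+1)θ/2)` (at `k = 2i+1`), `0 ≤ i < m/2`; for odd `m` it consists of
`f(θ)` (at `k = 0`) and `f(θ) sin(iθ)`, `f(θ) cos(iθ)` (at `k = 2i-1` and `k = 2i`),
`1 ≤ i ≤ (m-1)/2`. -/
def trigFamily (m : ℕ) (f : ℝ → ℝ) (k : Fin m) (θ : ℝ) : ℝ :=
  if Even m then
    if Even (k : ℕ) then f θ * Real.cos (((k : ℕ) + 1 : ℝ) / 2 * θ)
    else f θ * Real.sin (((k : ℕ) : ℝ) / 2 * θ)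
  else
    if Even (k : ℕ) then f θ * Real.cos (((k : ℕ) : ℝ) / 2 * θ)
    else f θ * Real.sin (((k : ℕ) + 1 : ℝ) / 2 * θ)

/-- AT system on the arc `{e^{iθ} : α ≤ θ ≤ β}` for the index `n`: there is a finite positive
measure `ν` supported on the arc with `dμ_j(e^{iθ}) = w_j(θ) dν(e^{iθ})`, such that the union of
the families `Trig_{n_j}(w_j)` is a Chebyshev system on `[α, β]`. -/
def IsATSystem {r : ℕ} (α β : ℝ) (μ : Fin r → Measure ℂ) (n : Fin r → ℕ) : Prop :=
  0 < β - α ∧ β - α ≤ 2 * Real.pi ∧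
  ∃ (ν : Measure ℂ) (w : Fin r → ℝ → ℝ),
    IsFiniteMeasure ν ∧ ν.support ⊆ circleArc α β ∧
    (∀ j, Measurable (w j)) ∧
    (∀ j, ∀ᵐ z ∂ν, 0 ≤ w j (argFrom α z)) ∧
    (∀ j, μ j = ν.withDensity fun z => ENNReal.ofReal (w j (argFrom α z))) ∧
    IsChebyshevSystem (fun i : (Σ j : Fin r, Fin (n j)) => trigFamily (n i.1) (w i.1) i.2)
      (Set.Icc α β)

end LaurentMOPUC

end

/-!
The idea is to turn the orthogonality relations into a statement about trigonometric polynomials.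
Put `N = |n|`, and let `P` be the polynomial `z^{N/2} φ(z)`, monic of degree `N`. On the circle the
relations say that `z^{-(N-1)/2} P(z)` is orthogonal with respect to `μ_j` to the exponentials with
frequencies `-(n_j-1)/2, …, (n_j-1)/2`, a family which is closed under conjugation. Everything
follows from one property (`IsNondegenerate`): a trigonometric polynomial `z^{-(N-1)/2} W(z)` with
`deg W < N` which satisfies all these relations, possibly with an additional weight `|z - a|²`, is
zero.

Existence and uniqueness. The relations are a square linear system for the coefficients of `P`, and
nondegeneracy says that its homogeneous part has the trivial solution only
(`existsUnique_monic_isOrthogonal`).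

Zeros (`norm_lt_one_of_isRoot`). Along with `P`, each combination `S = c z P + conj(c) P^*`, of
degree `N + 1`, satisfies the symmetric relations, because these can be conjugated. If `S` has a
pair of zeros `a` and `1 / conj a`, or a double zero `a` on the circle, then on the circle `S` is
`z |z - a|²` times a polynomial of degree less than `N`, which nondegeneracy forbids
(`not_dvd_combination`). If `P` had a zero `ζ` with `|ζ| > 1`, then `P^*` would vanish at
`1 / conj ζ`, whereas `|z P| < |P^*|` at the origin; so `|z P| = |P^*|` at some point between the
two, and `S` vanishes there for a suitable `c`. If `P` had a zero on the circle, then `c` could be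
chosen so that it is a double zero of `S`.

Nondegeneracy (`eq_zero_of_forall_integral_eq_zero`). A nonzero `W` would make the matrix of the
integrals of the exponentials against the functions defining the relations singular. By Andréief's
identity, applied with one group of variables for each measure, the integral of the product of two
determinants would then vanish: the Vandermonde determinant of the `N` exponentials at `N` points,
and the determinant (in blocks) of the functions at these points. This product is real up to a
constant, continuous, and invariant under permutations within the blocks, and it is nonzero at
distinct points. Hence it has a constant sign (`nonneg_mul_of_block_symmetric`), and its integral is
not zero, since the supports are infinite. For an Angelesco system the blocks are the measures, and
every block contributes a Vandermonde determinant. For an AT system there is a single block, with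
the determinant of the Chebyshev system.
-/

open MeasureTheory Polynomial

namespace LaurentMOPUC

/-! ### Trigonometric exponentials with half-integer frequencies -/

/-- The exponential `e^{isθ/2}`, that is, the value of `z ^ (s / 2)` at the point `z` of the unit
circle with argument `θ`. -/
noncomputable def hexp (s : ℤ) (θ : ℝ) : ℂ := Complex.exp (Complex.I * s * θ / 2)

lemma hexp_zero (θ : ℝ) : hexp 0 θ = 1 := by simp [hexp]

lemma hexp_add (s t : ℤ) (θ : ℝ) : hexp (s + t) θ = hexp s θ * hexp t θ := by
  rw [hexp, hexp, hexp, ← Complex.exp_add]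
  congr 1
  push_cast
  ring

lemma hexp_pow (s : ℤ) (k : ℕ) (θ : ℝ) : hexp s θ ^ k = hexp (k * s) θ := by
  rw [hexp, hexp, ← Complex.exp_nat_mul]
  congr 1
  push_cast
  ring

lemma hexp_ne_zero (s : ℤ) (θ : ℝ) : hexp s θ ≠ 0 := Complex.exp_ne_zero _

lemma norm_hexp (s : ℤ) (θ : ℝ) : ‖hexp s θ‖ = 1 := by
  rw [hexp, show Complex.I * s * θ / 2 = ((s * θ / 2 : ℝ) : ℂ) * Complex.I by push_cast; ring,
    Complex.norm_exp_ofReal_mul_I]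

lemma star_hexp (s : ℤ) (θ : ℝ) : star (hexp s θ) = hexp (-s) θ := by
  rw [hexp, hexp, Complex.star_def, ← Complex.exp_conj]
  congr 1
  simp [map_ofNat]

lemma continuous_hexp (s : ℤ) : Continuous (hexp s) := by
  unfold hexp
  fun_prop

lemma hexp_two (θ : ℝ) : hexp 2 θ = Complex.exp (Complex.I * θ) := by
  rw [hexp]
  congr 1
  push_cast
  ring

lemma hexp_two_injOn (t : ℝ) : Set.InjOn (hexp 2) (Set.Ico t (t + 2 * Real.pi)) := by
  intro x hx y hy h
  rw [hexp_two, hexp_two, Complex.exp_eq_exp_iff_exists_int] at h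
  obtain ⟨m, hm⟩ := h
  have h1 : x = y + m * (2 * Real.pi) := by
    have h2 := congrArg Complex.im hm
    simpa using h2
  have hpi := Real.pi_pos
  have hm0 : m = 0 := by
    by_contra hne
    rcases lt_or_gt_of_ne hne with hlt | hgt
    · have : (m : ℝ) ≤ -1 := by exact_mod_cast (by omega : m ≤ -1)
      nlinarith [hx.1, hy.2]
    · have : (1 : ℝ) ≤ m := by exact_mod_cast hgt
      nlinarith [hx.2, hy.1]
  rw [h1, hm0]
  simp

/-- The determinant of the exponentials `e^{i(l - (m-1)/2)θ}`, `0 ≤ l < m`, at the points `x`. -/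
noncomputable def hexpDet (m : ℕ) (x : Fin m → ℝ) : ℂ :=
  (Matrix.of fun l k : Fin m => hexp (2 * (l : ℤ) + 1 - m) (x k)).det

lemma hexpDet_eq_vandermonde (m : ℕ) (x : Fin m → ℝ) :
    hexpDet m x = (∏ k, hexp (1 - m) (x k)) * (Matrix.vandermonde fun k => hexp 2 (x k)).det := by
  rw [hexpDet, ← Matrix.det_transpose (Matrix.vandermonde _), ← Matrix.det_mul_row]
  congr 1
  ext l k
  simp only [Matrix.of_apply, Matrix.transpose_apply, Matrix.vandermonde_apply]
  rw [hexp_pow, ← hexp_add]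
  congr 1
  ring

lemma hexpDet_ne_zero_iff {m : ℕ} {x : Fin m → ℝ} :
    hexpDet m x ≠ 0 ↔ Function.Injective fun k => hexp 2 (x k) := by
  rw [hexpDet_eq_vandermonde, ← Matrix.det_vandermonde_ne_zero_iff, mul_ne_zero_iff]
  exact and_iff_right (Finset.prod_ne_zero_iff.2 fun k _ => hexp_ne_zero _ _)

/-- Conjugation reverses the order of the exponentials, so that it changes the determinant by a
sign which depends on `m` only. -/
lemma star_hexpDet (m : ℕ) (x : Fin m → ℝ) :
    star (hexpDet m x) = ((Equiv.Perm.sign (Fin.revPerm : Equiv.Perm (Fin m)) : ℤ) : ℂ) *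
      hexpDet m x := by
  rw [hexpDet, ← Matrix.det_permute, ← Matrix.det_conjTranspose, ← Matrix.det_transpose]
  congr 1
  ext l k
  simp only [Matrix.conjTranspose_apply, Matrix.transpose_apply, Matrix.of_apply, star_hexp,
    Matrix.submatrix_apply, id, Fin.revPerm_apply, Fin.val_rev]
  congr 1
  have := l.2
  omega

lemma exists_mul_hexpDet_real (m : ℕ) :
    ∃ c : ℂ, c ≠ 0 ∧ ∀ x : Fin m → ℝ, (c * hexpDet m x).im = 0 := by
  rcases Int.units_eq_one_or (Equiv.Perm.sign (Fin.revPerm : Equiv.Perm (Fin m))) with h | h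
  · refine ⟨1, one_ne_zero, fun x => ?_⟩
    have := star_hexpDet m x
    rw [h] at this
    simpa using Complex.conj_eq_iff_im.1 (by simpa using this)
  · refine ⟨Complex.I, Complex.I_ne_zero, fun x => ?_⟩
    have h1 := star_hexpDet m x
    rw [h] at h1
    have h2 := congrArg Complex.re h1
    simp at h2
    simp
    linarith

lemma continuous_hexpDet (m : ℕ) : Continuous (hexpDet m) := by
  unfold hexpDet
  refine Continuous.matrix_det (continuous_matrix fun l k => ?_)
  exact (continuous_hexp _).comp (continuous_apply k)

/-! ### Signs of functions which are symmetric within blocks -/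

/-- Two tuples whose entries are arranged in blocks can be brought into the same order within every
block, by a permutation which preserves the blocks. -/
lemma exists_perm_strictMono_within_blocks {N : ℕ} {κ : Type*} [LinearOrder κ] (b : Fin N → κ)
    (x y : Fin N → ℝ) (hy : Function.Injective y) :
    ∃ σ : Equiv.Perm (Fin N), (∀ i, b (σ i) = b i) ∧
      ∀ i k, b i = b k → x i < x k → y (σ i) < y (σ k) := by
  let X : Fin N → κ ×ₗ ℝ := fun i => toLex (b i, x i)
  let Y : Fin N → κ ×ₗ ℝ := fun i => toLex (b i, y i)
  have hX : Monotone (X ∘ Tuple.sort X) := Tuple.monotone_sort X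
  have hY : Monotone (Y ∘ Tuple.sort Y) := Tuple.monotone_sort Y
  have hb : b ∘ Tuple.sort X = b ∘ Tuple.sort Y :=
    Tuple.unique_monotone (Prod.Lex.monotone_fst_ofLex.comp hX)
      (Prod.Lex.monotone_fst_ofLex.comp hY)
  have hb' : ∀ a, b (Tuple.sort X a) = b (Tuple.sort Y a) := fun a => congrFun hb a
  refine ⟨(Tuple.sort X).symm.trans (Tuple.sort Y), fun i => ?_, fun i k hik hlt => ?_⟩
  · simp [← hb']
  · obtain ⟨p, rfl⟩ := (Tuple.sort X).surjective i
    obtain ⟨q, rfl⟩ := (Tuple.sort X).surjective k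
    simp only [Equiv.trans_apply, Equiv.symm_apply_apply]
    have hpq : p < q := by
      by_contra! hqp
      have h1 := hX hqp
      simp only [Function.comp, X, Prod.Lex.le_iff, ofLex_toLex] at h1
      rcases h1 with h1 | h1
      · exact absurd hik h1.ne'
      · exact absurd hlt (not_lt.2 h1.2)
    have h1 := hY hpq.le
    simp only [Function.comp, Y, Prod.Lex.le_iff, ofLex_toLex, ← hb', hik] at h1
    rcases h1 with h1 | h1
    · exact absurd h1 (lt_irrefl _)
    · exact lt_of_le_of_ne h1.2 fun h => hpq.ne ((Tuple.sort Y).injective (hy h))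

/-- A continuous function on a box whose sides depend on the blocks only has a constant sign if it
is invariant under the permutations preserving the blocks, vanishes at tuples with repeated entries
and does not vanish at the other tuples in the interior of the box. Two tuples which are ordered in
the same way are joined by a segment on which the entries of a block remain distinct. -/
lemma nonneg_mul_of_block_symmetric {N : ℕ} {κ : Type*} [LinearOrder κ] (b : Fin N → κ)
    (A B : κ → ℝ) (hsep : ∀ j k, j ≠ k → Disjoint (Set.Ioo (A j) (B j)) (Set.Ioo (A k) (B k)))
    (F : (Fin N → ℝ) → ℝ)
    (hcont : ContinuousOn F (Set.univ.pi fun i => Set.Icc (A (b i)) (B (b i))))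
    (hsymm : ∀ (σ : Equiv.Perm (Fin N)), (∀ i, b (σ i) = b i) → ∀ x, F (x ∘ σ) = F x)
    (hzero : ∀ x, ¬ Function.Injective x → F x = 0)
    (hne : ∀ x, Function.Injective x → (∀ i, x i ∈ Set.Ioo (A (b i)) (B (b i))) → F x ≠ 0)
    (p y : Fin N → ℝ) (hp : Function.Injective p) (hpI : ∀ i, p i ∈ Set.Ioo (A (b i)) (B (b i)))
    (hy : ∀ i, y i ∈ Set.Icc (A (b i)) (B (b i))) : 0 ≤ F p * F y := by
  by_cases hyi : Function.Injective y
  swap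
  · simp [hzero y hyi]
  obtain ⟨σ, hσb, hσ⟩ := exists_perm_strictMono_within_blocks b y p hp
  set q : Fin N → ℝ := p ∘ σ with hq
  have hqI : ∀ i, q i ∈ Set.Ioo (A (b i)) (B (b i)) := fun i => by
    have := hpI (σ i)
    rwa [hσb] at this
  let g : ℝ → Fin N → ℝ := fun t i => (1 - t) * y i + t * q i
  have hgI : ∀ t ∈ Set.Ioc (0 : ℝ) 1, ∀ i, g t i ∈ Set.Ioo (A (b i)) (B (b i)) := by
    intro t ht i
    have h1 := hqI i
    have h2 := hy i
    constructor
    · nlinarith [mul_pos ht.1 (sub_pos.2 h1.1),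
        mul_nonneg (sub_nonneg.2 ht.2) (sub_nonneg.2 h2.1)]
    · nlinarith [mul_pos ht.1 (sub_pos.2 h1.2),
        mul_nonneg (sub_nonneg.2 ht.2) (sub_nonneg.2 h2.2)]
  have hgne : ∀ t ∈ Set.Ioc (0 : ℝ) 1, F (g t) ≠ 0 := by
    intro t ht
    refine hne _ (fun i k hik => ?_) (hgI t ht)
    have hbik : b i = b k := by
      by_contra hbne
      exact Set.disjoint_left.1 (hsep _ _ hbne) (hgI t ht i) (hik ▸ hgI t ht k)
    by_contra hne'
    have key : ∀ i k, b i = b k → y i < y k → g t i < g t k := fun i k hb hlt => by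
      have h1 := hσ i k hb hlt
      have h2 : q i < q k := h1
      have := mul_nonneg (sub_nonneg.2 ht.2) (sub_nonneg.2 hlt.le)
      have := mul_pos ht.1 (sub_pos.2 h2)
      simp only [g]
      nlinarith
    rcases lt_or_gt_of_ne (fun h => hne' (hyi h)) with h | h
    · exact (key i k hbik h).ne hik
    · exact (key k i hbik.symm h).ne' hik
  have hgc : ContinuousOn (fun t => F p * F (g t)) (Set.Icc 0 1) := by
    refine continuousOn_const.mul (hcont.comp ?_ ?_)
    · exact (continuous_pi fun i => by fun_prop).continuousOn
    · intro t ht i _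
      rcases eq_or_lt_of_le ht.1 with h | h
      · simpa [g, ← h] using hy i
      · exact Set.Ioo_subset_Icc_self (hgI t ⟨h, ht.2⟩ i)
  have hg1 : g 1 = q := by ext i; simp [g]
  have hg0 : g 0 = y := by ext i; simp [g]
  have hFq : F q = F p := hsymm σ hσb p
  have hFp : F p ≠ 0 := hne p hp hpI
  by_contra! hneg
  have hmem : (0 : ℝ) ∈ Set.Icc (F p * F (g 0)) (F p * F (g 1)) := by
    rw [hg0, hg1, hFq]
    exact ⟨hneg.le, mul_self_nonneg _⟩
  obtain ⟨t, ht, hFt⟩ := intermediate_value_Icc zero_le_one hgc hmem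
  rcases eq_or_lt_of_le ht.1 with h | h
  · rw [← h] at hFt
    exact hneg.ne (by simpa only [hg0] using hFt)
  · exact mul_ne_zero hFp (hgne t ⟨h, ht.2⟩) hFt

/-! ### Andréief's identity in blocks -/

/-- The determinant of the functions `v i` at the points `x k`, in which an entry counts only if
`i` and `k` belong to the same block of `b`. -/
noncomputable def blockDet {N : ℕ} {κ : Type*} [DecidableEq κ] (b : Fin N → κ)
    (v : Fin N → ℝ → ℂ) (x : Fin N → ℝ) : ℂ :=
  (Matrix.of fun i k : Fin N => if b i = b k then v i (x k) else 0).det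

lemma blockDet_comp_perm {N : ℕ} {κ : Type*} [DecidableEq κ] (b : Fin N → κ)
    (v : Fin N → ℝ → ℂ) (x : Fin N → ℝ) (σ : Equiv.Perm (Fin N)) (hσ : ∀ i, b (σ i) = b i) :
    blockDet b v (x ∘ σ) = ((Equiv.Perm.sign σ : ℤ) : ℂ) * blockDet b v x := by
  rw [blockDet, blockDet, ← Matrix.det_permute']
  congr 1
  ext i k
  simp [hσ]

lemma hexpDet_comp_perm {N : ℕ} (x : Fin N → ℝ) (σ : Equiv.Perm (Fin N)) :
    hexpDet N (x ∘ σ) = ((Equiv.Perm.sign σ : ℤ) : ℂ) * hexpDet N x := by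
  rw [hexpDet, hexpDet, ← Matrix.det_permute']
  congr 1

lemma blockDet_mul {N : ℕ} {κ : Type*} [DecidableEq κ] (b : Fin N → κ)
    (v : Fin N → ℝ → ℂ) (G : ℝ → ℂ) (x : Fin N → ℝ) :
    blockDet b (fun i θ => G θ * v i θ) x = (∏ k, G (x k)) * blockDet b v x := by
  rw [blockDet, blockDet, ← Matrix.det_mul_row]
  congr 1
  ext i k
  simp

lemma continuousOn_blockDet {N : ℕ} {κ : Type*} [DecidableEq κ] (b : Fin N → κ)
    (v : Fin N → ℝ → ℂ) (I : κ → Set ℝ) (hv : ∀ i, ContinuousOn (v i) (I (b i))) :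
    ContinuousOn (blockDet b v) (Set.univ.pi fun i => I (b i)) := by
  rw [continuousOn_iff_continuous_domRestrict]
  refine Continuous.matrix_det (continuous_matrix fun i k => ?_)
  by_cases h : b i = b k
  · simp only [Matrix.of_apply, h, if_true]
    refine (hv i).comp_continuous ((continuous_apply k).comp continuous_subtype_val) fun x => ?_
    rw [h]
    exact x.2 k trivial
  · simp only [Matrix.of_apply, h, if_false]
    exact continuous_const

/-- If the moment matrix is singular, then the integral of the product of the two determinants is
zero: by Andréief's identity it is a multiple of the determinant of the moment matrix. -/
lemma integral_hexpDet_mul_blockDet_eq_zero {N : ℕ} {κ : Type*} [DecidableEq κ] (b : Fin N → κ)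
    (ν : κ → Measure ℝ) [∀ j, IsFiniteMeasure (ν j)] (v : Fin N → ℝ → ℂ)
    (hint : ∀ (s : ℤ) i, Integrable (fun θ => hexp s θ * v i θ) (ν (b i)))
    (hdet : (Matrix.of fun l i : Fin N =>
      ∫ θ, hexp (2 * (l : ℤ) + 1 - N) θ * v i θ ∂ν (b i)).det = 0) :
    Integrable (fun x => hexpDet N x * blockDet b v x) (Measure.pi fun i => ν (b i)) ∧
    ∫ x, hexpDet N x * blockDet b v x ∂(Measure.pi fun i => ν (b i)) = 0 := by
  -- the term of a permutation `σ` of the second determinant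
  let T : Equiv.Perm (Fin N) → Equiv.Perm (Fin N) → (Fin N → ℝ) → ℂ := fun σ τ x =>
    ∏ k, (hexp (2 * (τ k : ℕ) + 1 - N) (x k) * if b (σ k) = b k then v (σ k) (x k) else 0)
  have hfac : ∀ (σ : Equiv.Perm (Fin N)) (l k : Fin N), Integrable
      (fun θ => hexp (2 * (l : ℤ) + 1 - N) θ * if b (σ k) = b k then v (σ k) θ else 0)
      (ν (b k)) := by
    intro σ l k
    by_cases h : b (σ k) = b k
    · simp only [h, if_true]
      have := hint (2 * (l : ℤ) + 1 - N) (σ k)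
      rwa [h] at this
    · simp [h]
  have hTint : ∀ σ τ, Integrable (T σ τ) (Measure.pi fun i => ν (b i)) := fun σ τ =>
    Integrable.fintype_prod (f := fun k θ => hexp (2 * (τ k : ℕ) + 1 - N) θ *
      if b (σ k) = b k then v (σ k) θ else 0) fun k => hfac σ (τ k) k
  have hexpand : (fun x => hexpDet N x * blockDet b v x) = fun x => ∑ σ : Equiv.Perm (Fin N),
      ((Equiv.Perm.sign σ : ℤ) : ℂ) * ∑ τ : Equiv.Perm (Fin N),
        ((Equiv.Perm.sign τ : ℤ) : ℂ) * T σ τ x := by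
    ext x
    rw [blockDet, Matrix.det_apply', Finset.mul_sum]
    refine Finset.sum_congr rfl fun σ _ => ?_
    rw [hexpDet, Matrix.det_apply', mul_left_comm, Finset.sum_mul]
    congr 1
    refine Finset.sum_congr rfl fun τ _ => ?_
    simp only [T, Finset.prod_mul_distrib, Matrix.of_apply, mul_assoc]
  have hinner : ∀ σ : Equiv.Perm (Fin N), Integrable (fun x => ∑ τ : Equiv.Perm (Fin N),
      ((Equiv.Perm.sign τ : ℤ) : ℂ) * T σ τ x) (Measure.pi fun i => ν (b i)) := fun σ =>
    integrable_finsetSum _ fun τ _ => (hTint σ τ).const_mul _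
  rw [hexpand]
  refine ⟨integrable_finsetSum _ fun σ _ => (hinner σ).const_mul _, ?_⟩
  rw [integral_finsetSum _ fun σ _ => (hinner σ).const_mul _]
  refine Finset.sum_eq_zero fun σ _ => ?_
  rw [integral_const_mul, integral_finsetSum _ fun τ _ => (hTint σ τ).const_mul _]
  refine mul_eq_zero_of_right _ ?_
  have hT : ∀ τ, ∫ x, T σ τ x ∂(Measure.pi fun i => ν (b i)) =
      ∏ k, ∫ θ, hexp (2 * (τ k : ℕ) + 1 - N) θ *
        (if b (σ k) = b k then v (σ k) θ else 0) ∂ν (b k) := fun τ =>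
    integral_fintype_prod_eq_prod (fun k θ => hexp (2 * (τ k : ℕ) + 1 - N) θ *
      if b (σ k) = b k then v (σ k) θ else 0)
  simp_rw [integral_const_mul, hT]
  by_cases hσ : ∀ k, b (σ k) = b k
  · -- the sum over `τ` is the determinant of the moment matrix with permuted columns
    have h := Matrix.det_permute' σ (Matrix.of fun l i : Fin N =>
      ∫ θ, hexp (2 * (l : ℤ) + 1 - N) θ * v i θ ∂ν (b i))
    rw [hdet, mul_zero, Matrix.det_apply'] at h
    rw [← h]
    simp [hσ]
  · push Not at hσ
    obtain ⟨k, hk⟩ := hσ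
    refine Finset.sum_eq_zero fun τ _ => mul_eq_zero_of_right _ ?_
    exact Finset.prod_eq_zero (Finset.mem_univ k) (by simp [hk])

lemma exists_injective_mem_of_infinite {N : ℕ} {X : Type*} {S : Fin N → Set X}
    (hS : ∀ i, (S i).Infinite) : ∃ p : Fin N → X, Function.Injective p ∧ ∀ i, p i ∈ S i := by
  induction N with
  | zero => exact ⟨Fin.elim0, fun i => i.elim0, fun i => i.elim0⟩
  | succ N ih =>
    obtain ⟨p, hp, hpS⟩ := ih fun i => hS i.succ
    obtain ⟨a, ha, hap⟩ := ((hS 0).sdiff (Set.finite_range p)).nonempty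
    refine ⟨Fin.cons a p, Fin.cons_injective_iff.2 ⟨hap, hp⟩, Fin.cases ?_ ?_⟩
    · simpa using ha
    · simpa using hpS

/-- A trigonometric polynomial of degree `(N - 1) / 2` which is orthogonal, with a weight `G`, to
`N` functions vanishes, if the block determinant of these functions is real up to a constant factor
and does not vanish at distinct points. -/
theorem eq_zero_of_forall_integral_eq_zero {N : ℕ} {κ : Type*} [LinearOrder κ] (b : Fin N → κ)
    (ν : κ → Measure ℝ) [∀ j, IsFiniteMeasure (ν j)] (t : ℝ) (A B : κ → ℝ)
    (hAB : ∀ j, t ≤ A j ∧ B j ≤ t + 2 * Real.pi)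
    (hsep : ∀ j k, j ≠ k → Disjoint (Set.Ioo (A j) (B j)) (Set.Ioo (A k) (B k)))
    (hν : ∀ j, ∀ᵐ θ ∂ν j, θ ∈ Set.Icc (A j) (B j))
    (hsupp : ∀ i, ((ν (b i)).support ∩ Set.Ioo (A (b i)) (B (b i))).Infinite)
    (v : Fin N → ℝ → ℂ) (hv : ∀ i, ContinuousOn (v i) (Set.Icc (A (b i)) (B (b i))))
    (hreal : ∃ c : ℂ, c ≠ 0 ∧ ∀ x, (c * blockDet b v x).im = 0)
    (hne : ∀ x, Function.Injective x → (∀ i, x i ∈ Set.Ioo (A (b i)) (B (b i))) →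
      blockDet b v x ≠ 0)
    (G : ℝ → ℝ) (hG : Continuous G) (hG0 : ∀ θ, 0 ≤ G θ)
    (hGz : {θ | θ ∈ Set.Ioo t (t + 2 * Real.pi) ∧ G θ = 0}.Finite)
    (W : ℂ[X]) (hW : W.degree < N)
    (horth : ∀ i, ∫ θ, hexp (1 - N) θ * W.eval (hexp 2 θ) * G θ * v i θ ∂ν (b i) = 0) :
    W = 0 := by
  obtain ⟨c, hc, hreal⟩ := hreal
  obtain ⟨d, hd, hdreal⟩ := exists_mul_hexpDet_real N
  set g : Fin N → ℝ → ℂ := fun i θ => G θ * v i θ with hg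
  have hgc : ∀ i, ContinuousOn (g i) (Set.Icc (A (b i)) (B (b i))) := fun i =>
    (Complex.continuous_ofReal.comp hG).continuousOn.mul (hv i)
  have hint : ∀ (s : ℤ) i, Integrable (fun θ => hexp s θ * g i θ) (ν (b i)) := by
    intro s i
    rw [← Measure.restrict_eq_self_of_ae_mem (hν (b i))]
    exact ((continuous_hexp s).continuousOn.mul (hgc i)).integrableOn_Icc
  by_contra hW0
  -- the coefficients of `W` are a linear relation between the rows of the moment matrix
  have hdet : (Matrix.of fun l i : Fin N =>
      ∫ θ, hexp (2 * (l : ℤ) + 1 - N) θ * g i θ ∂ν (b i)).det = 0 := by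
    refine Matrix.exists_vecMul_eq_zero_iff.1 ⟨fun l => W.coeff l, fun h => hW0 ?_, ?_⟩
    · ext m
      by_cases hm : m < N
      · simpa using congrFun h ⟨m, hm⟩
      · exact coeff_eq_zero_of_degree_lt (hW.trans_le (by exact_mod_cast not_lt.1 hm))
    · ext i
      rw [Pi.zero_apply, ← horth i]
      simp only [Matrix.vecMul, dotProduct, Matrix.of_apply]
      simp_rw [← integral_const_mul]
      rw [← integral_finsetSum _ fun l _ => (hint _ i).const_mul _]
      congr 1
      ext θ
      rw [eval_eq_sum_range' ((natDegree_lt_iff_degree_lt hW0).2 hW), ← Fin.sum_univ_eq_sum_range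
        (fun l => W.coeff l * hexp 2 θ ^ l), Finset.mul_sum, Finset.sum_mul, Finset.sum_mul]
      refine Finset.sum_congr rfl fun l _ => ?_
      rw [hexp_pow, show (2 * (l : ℤ) + 1 - N) = (1 - N) + (l : ℕ) * 2 by ring, hexp_add]
      simp only [hg]
      ring
  obtain ⟨hI, hI0⟩ := integral_hexpDet_mul_blockDet_eq_zero b ν g hint hdet
  set F : (Fin N → ℝ) → ℝ := fun x => (d * hexpDet N x * (c * blockDet b v x)).re with hF
  have hFeq : ∀ x, ((F x : ℝ) : ℂ) = d * hexpDet N x * (c * blockDet b v x) := fun x => by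
    apply Complex.ext
    · simp [hF]
    · rw [Complex.mul_im, hdreal, hreal]
      simp
  have hinj : ∀ x : Fin N → ℝ, Function.Injective x →
      (∀ i, x i ∈ Set.Ioo (A (b i)) (B (b i))) → hexpDet N x ≠ 0 := by
    intro x hx hxI
    refine hexpDet_ne_zero_iff.2 fun i k h => hx (hexp_two_injOn t ?_ ?_ h)
    · exact ⟨(hAB _).1.trans (hxI i).1.le, (hxI i).2.trans_le (hAB _).2⟩
    · exact ⟨(hAB _).1.trans (hxI k).1.le, (hxI k).2.trans_le (hAB _).2⟩
  have hFne : ∀ x, Function.Injective x → (∀ i, x i ∈ Set.Ioo (A (b i)) (B (b i))) →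
      F x ≠ 0 := by
    intro x hx hxI h
    have h1 := hFeq x
    rw [h, Complex.ofReal_zero] at h1
    exact mul_ne_zero (mul_ne_zero hd (hinj x hx hxI)) (mul_ne_zero hc (hne x hx hxI)) h1.symm
  have hFc : ContinuousOn F (Set.univ.pi fun i => Set.Icc (A (b i)) (B (b i))) :=
    Complex.continuous_re.comp_continuousOn
      ((continuous_const.mul (continuous_hexpDet N)).continuousOn.mul
        (continuousOn_const.mul (continuousOn_blockDet b v (fun j => Set.Icc (A j) (B j)) hv)))
  -- distinct points of the supports, in the interior of the intervals, where `G` is positive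
  obtain ⟨p, hpinj, hp⟩ : ∃ p : Fin N → ℝ, Function.Injective p ∧ ∀ i,
      p i ∈ (ν (b i)).support ∩ Set.Ioo (A (b i)) (B (b i)) ∧ 0 < G (p i) := by
    obtain ⟨p, hpinj, hp⟩ := exists_injective_mem_of_infinite fun i =>
      (hsupp i).sdiff hGz
    refine ⟨p, hpinj, fun i => ⟨(hp i).1, (hG0 _).lt_of_ne' fun h => (hp i).2 ⟨?_, h⟩⟩⟩
    have := (hp i).1.2
    exact ⟨(hAB _).1.trans_lt this.1, this.2.trans_le (hAB _).2⟩
  have hpI : ∀ i, p i ∈ Set.Ioo (A (b i)) (B (b i)) := fun i => (hp i).1.2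
  have hnonneg : ∀ y : Fin N → ℝ, (∀ i, y i ∈ Set.Icc (A (b i)) (B (b i))) →
      0 ≤ F p * F y := by
    intro y hy
    refine nonneg_mul_of_block_symmetric b A B hsep F hFc (fun σ hσ x => ?_) (fun x hx => ?_)
      hFne p y hpinj hpI hy
    · simp only [hF]
      rw [hexpDet_comp_perm, blockDet_comp_perm b v x σ hσ]
      congr 1
      have : ((Equiv.Perm.sign σ : ℤ) : ℂ) * ((Equiv.Perm.sign σ : ℤ) : ℂ) = 1 := by
        rcases Int.units_eq_one_or (Equiv.Perm.sign σ) with h | h <;> simp [h]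
      linear_combination (d * hexpDet N x * (c * blockDet b v x)) * this
    · have : hexpDet N x = 0 := by
        by_contra h
        exact hx (Function.Injective.of_comp (f := hexp 2) (hexpDet_ne_zero_iff.1 h))
      simp [hF, this]
  -- the integrand of Andréief's identity, normalized so as to be nonnegative
  set K : (Fin N → ℝ) → ℝ := fun x => F p * F x * ∏ i, G (x i) with hK
  have hKeq : ∀ x, ((K x : ℝ) : ℂ) = F p * d * c * (hexpDet N x * blockDet b g x) := by
    intro x
    have h1 := hFeq x
    rw [hg, blockDet_mul b v (fun θ => (G θ : ℂ))]
    simp only [hK, Complex.ofReal_mul, Complex.ofReal_prod, h1]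
    ring
  have hKint : Integrable K (Measure.pi fun i => ν (b i)) := by
    have := (hI.const_mul ((F p : ℂ) * d * c)).re
    refine this.congr (Filter.Eventually.of_forall fun x => ?_)
    simp [← hKeq]
  have hK0 : ∫ x, K x ∂(Measure.pi fun i => ν (b i)) = 0 := by
    have : ((∫ x, K x ∂(Measure.pi fun i => ν (b i)) : ℝ) : ℂ) = 0 := by
      rw [← integral_complex_ofReal]
      simp_rw [hKeq]
      rw [integral_const_mul, hI0, mul_zero]
    exact_mod_cast this
  have hbox : ∀ᵐ x ∂(Measure.pi fun i => ν (b i)),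
      x ∈ Set.univ.pi fun i => Set.Icc (A (b i)) (B (b i)) := by
    have : ∀ i, ∀ᵐ x ∂(Measure.pi fun i => ν (b i)), x i ∈ Set.Icc (A (b i)) (B (b i)) :=
      fun i => (Measure.tendsto_eval_ae_ae (μ := fun i => ν (b i)) (i := i)).eventually (hν (b i))
    filter_upwards [ae_all_iff.2 this] with x hx i _ using hx i
  have hKnn : 0 ≤ᵐ[Measure.pi fun i => ν (b i)] K := by
    filter_upwards [hbox] with x hx
    exact mul_nonneg (hnonneg x fun i => hx i trivial) (Finset.prod_nonneg fun i _ => hG0 _)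
  have hKae := (integral_eq_zero_iff_of_nonneg_ae hKnn hKint).1 hK0
  have hKp : 0 < K p := by
    refine mul_pos ?_ (Finset.prod_pos fun i _ => (hp i).2)
    exact mul_self_pos.2 (hFne p hpinj hpI)
  have hnhds : (Set.univ.pi fun i => Set.Icc (A (b i)) (B (b i))) ∈ nhds p :=
    set_pi_mem_nhds Set.finite_univ fun i _ => Icc_mem_nhds (hpI i).1 (hpI i).2
  have hKc : ContinuousAt K p := by
    refine ContinuousAt.mul (continuousAt_const.mul (hFc.continuousAt hnhds)) ?_
    exact (continuous_finsetProd _ fun i _ => hG.comp (continuous_apply i)).continuousAt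
  have hpos := hKc.eventually (lt_mem_nhds hKp)
  rw [Filter.Eventually, nhds_pi, Filter.mem_pi'] at hpos
  obtain ⟨I, V, hV, hVs⟩ := hpos
  have hmeas : 0 < Measure.pi (fun i => ν (b i)) (Set.univ.pi V) := by
    rw [Measure.pi_pi]
    refine pos_iff_ne_zero.2 (Finset.prod_ne_zero_iff.2 fun i _ => ?_)
    exact (((ν (b i)).mem_support_iff_forall (p i)).1 (hp i).1.1 _ (hV i)).ne'
  refine hmeas.ne' (measure_mono_null (fun x hx => ?_) hKae)
  have : 0 < K x := hVs fun i _ => hx i trivial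
  exact this.ne'

/-! ### Orthogonality relations and the location of zeros -/

/-- The function `f` of the angle satisfies the orthogonality relations of the index `n` with
respect to the measures `ρ j` on the line, in symmetric form: it is orthogonal to all exponentials
with frequencies `-(n_j-1)/2, …, (n_j-1)/2`. -/
def IsOrthogonal {r : ℕ} (ρ : Fin r → Measure ℝ) (n : Fin r → ℕ) (f : ℝ → ℂ) : Prop :=
  ∀ (j : Fin r) (k : Fin (n j)), ∫ θ, f θ * hexp (2 * (k : ℤ) + 1 - n j) θ ∂ρ j = 0

/-- The only trigonometric polynomial of degree `(|n| - 1) / 2` which satisfies the orthogonality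
relations, for the measures `ρ j` or for the measures `|e^{iθ} - a|² dρ_j(θ)`, is zero. -/
def IsNondegenerate {r : ℕ} (ρ : Fin r → Measure ℝ) (n : Fin r → ℕ) : Prop :=
  ∀ (a : ℂ) (W : ℂ[X]), W.degree < size n →
    IsOrthogonal ρ n (fun θ =>
      hexp (1 - size n) θ * W.eval (hexp 2 θ) * ((‖hexp 2 θ - a‖ ^ 2 : ℝ) : ℂ)) → W = 0

section
variable {r : ℕ} {ρ : Fin r → Measure ℝ} {n : Fin r → ℕ} {f g : ℝ → ℂ}

lemma IsOrthogonal.star (hf : IsOrthogonal ρ n f) :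
    IsOrthogonal ρ n fun θ => star (f θ) := by
  intro j k
  have h := congrArg (starRingEnd ℂ) (hf j k.rev)
  rw [← integral_conj, map_zero] at h
  rw [← h]
  congr 1
  ext θ
  rw [map_mul, starRingEnd_apply, starRingEnd_apply, star_hexp, Fin.val_rev]
  congr 2
  have := k.2
  omega

lemma integrable_mul_hexp (μ : Measure ℝ) [IsFiniteMeasure μ] (hf : Continuous f)
    (hb : ∃ C, ∀ θ, ‖f θ‖ ≤ C) (s : ℤ) : Integrable (fun θ => f θ * hexp s θ) μ := by
  obtain ⟨C, hC⟩ := hb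
  refine Integrable.of_bound (hf.mul (continuous_hexp s)).aestronglyMeasurable C
    (Filter.Eventually.of_forall fun θ => ?_)
  rw [norm_mul, norm_hexp, mul_one]
  exact hC θ

lemma continuous_hexp_mul_eval (s : ℤ) (P : ℂ[X]) :
    Continuous fun θ => hexp s θ * P.eval (hexp 2 θ) :=
  (continuous_hexp s).mul (P.continuous.comp (continuous_hexp 2))

lemma exists_norm_hexp_mul_eval_le (s : ℤ) (P : ℂ[X]) :
    ∃ C, ∀ θ, ‖hexp s θ * P.eval (hexp 2 θ)‖ ≤ C := by
  obtain ⟨C, hC⟩ := (isCompact_sphere (0 : ℂ) 1).exists_bound_of_continuousOn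
    P.continuous.continuousOn
  refine ⟨C, fun θ => ?_⟩
  rw [norm_mul, norm_hexp, one_mul]
  exact hC _ (by simp [norm_hexp])

lemma IsOrthogonal.add_mul [∀ j, IsFiniteMeasure (ρ j)] (hf : IsOrthogonal ρ n f)
    (hg : IsOrthogonal ρ n g) (hfc : Continuous f) (hgc : Continuous g)
    (hfb : ∃ C, ∀ θ, ‖f θ‖ ≤ C) (hgb : ∃ C, ∀ θ, ‖g θ‖ ≤ C) (c d : ℂ) :
    IsOrthogonal ρ n fun θ => c * f θ + d * g θ := by
  intro j k
  have h : (fun θ => (c * f θ + d * g θ) * hexp (2 * (k : ℤ) + 1 - n j) θ) = fun θ =>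
      c * (f θ * hexp (2 * (k : ℤ) + 1 - n j) θ) + d * (g θ * hexp (2 * (k : ℤ) + 1 - n j) θ) := by
    ext θ
    ring
  rw [h, integral_add ((integrable_mul_hexp _ hfc hfb _).const_mul _)
    ((integrable_mul_hexp _ hgc hgb _).const_mul _), integral_const_mul, integral_const_mul,
    hf j k, hg j k]
  simp

end

/-- The reversed polynomial `P^*(z) = z^N conj(P(1 / conj z))`. -/
noncomputable def conjReflect (N : ℕ) (P : ℂ[X]) : ℂ[X] := (P.map (starRingEnd ℂ)).reflect N

lemma coeff_conjReflect (N : ℕ) (P : ℂ[X]) (m : ℕ) :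
    (conjReflect N P).coeff m = star (P.coeff (revAt N m)) := by
  rw [conjReflect, coeff_reflect, coeff_map, starRingEnd_apply]

lemma natDegree_conjReflect_le {N : ℕ} {P : ℂ[X]} (hP : P.natDegree ≤ N) :
    (conjReflect N P).natDegree ≤ N := by
  refine natDegree_le_iff_coeff_eq_zero.2 fun m hm => ?_
  rw [coeff_conjReflect, revAt_eq_self_of_lt hm, coeff_eq_zero_of_natDegree_lt (hP.trans_lt hm),
    star_zero]

lemma eval_conjReflect {N : ℕ} {P : ℂ[X]} (hP : P.natDegree ≤ N) {z : ℂ} (hz : z ≠ 0) :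
    (conjReflect N P).eval z = z ^ N * star (P.eval (star z)⁻¹) := by
  let _ : Invertible z⁻¹ := invertibleOfNonzero (inv_ne_zero hz)
  have h := eval₂_reflect_mul_pow (RingHom.id ℂ) z⁻¹ N (P.map (starRingEnd ℂ))
    (natDegree_map_le.trans hP)
  have h1 : (P.map (starRingEnd ℂ)).eval z⁻¹ = star (P.eval (star z)⁻¹) := by
    have h2 : z⁻¹ = starRingEnd ℂ (star z)⁻¹ := by simp
    rw [h2, eval_map, eval₂_at_apply, starRingEnd_apply]
  rw [invOf_eq_inv, inv_inv, eval₂_id, eval₂_id, h1] at h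
  rw [conjReflect, ← h, inv_pow]
  field_simp

/-- For numbers of equal modulus, the real-linear equation `c A + conj(c) B = 0` has a solution
`c ≠ 0`. -/
lemma exists_mul_add_star_mul_eq_zero {A B : ℂ} (h : ‖A‖ = ‖B‖) :
    ∃ c : ℂ, c ≠ 0 ∧ c * A + star c * B = 0 := by
  have hn : A * star A = B * star B := by
    rw [Complex.star_def, Complex.mul_conj, Complex.mul_conj,
      Complex.normSq_eq_norm_sq, Complex.normSq_eq_norm_sq, h]
  by_cases hA : A = 0
  · refine ⟨1, one_ne_zero, ?_⟩
    have : B = 0 := by rw [← norm_eq_zero, ← h, hA, norm_zero]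
    simp [hA, this]
  by_cases hB : star A = B
  · refine ⟨Complex.I * star A, mul_ne_zero Complex.I_ne_zero (star_ne_zero.2 hA), ?_⟩
    rw [← hB]
    simp
    ring
  · refine ⟨star A - B, sub_ne_zero.2 hB, ?_⟩
    rw [star_sub, star_star]
    linear_combination hn

section
variable {r : ℕ} {ρ : Fin r → Measure ℝ} {n : Fin r → ℕ} [∀ j, IsFiniteMeasure (ρ j)]
  {P : ℂ[X]}

/-- A combination `c z P + conj(c) P^*` satisfies the orthogonality relations if `P` does. A pair of
zeros `a` and `1 / conj a` of it (or a double zero on the circle) would amount to a factor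
`|z - a|²` on the circle, and the remaining factor would have too low a degree. -/
lemma not_dvd_combination (hρ : IsNondegenerate ρ n) (hP : P.Monic)
    (hdeg : P.natDegree = size n)
    (horth : IsOrthogonal ρ n fun θ => hexp (1 - size n) θ * P.eval (hexp 2 θ))
    {c a : ℂ} (hc : c ≠ 0) (ha : a ≠ 0) :
    ¬ (X - C a) * (1 - C (star a) * X) ∣ C c * (X * P) + C (star c) * conjReflect (size n) P := by
  rintro ⟨W, hW⟩
  set S : ℂ[X] := C c * (X * P) + C (star c) * conjReflect (size n) P with hS
  have hcoeff : S.coeff (size n + 1) = c := by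
    have h1 : (conjReflect (size n) P).coeff (size n + 1) = 0 :=
      coeff_eq_zero_of_natDegree_lt
        ((natDegree_conjReflect_le hdeg.le).trans_lt (Nat.lt_succ_self _))
    have h2 : P.coeff (size n) = 1 := by rw [← hdeg]; exact hP
    simp [hS, h1, h2]
  have hSdeg : S.natDegree ≤ size n + 1 := by
    refine (natDegree_add_le _ _).trans (max_le ?_ ?_)
    · refine (natDegree_C_mul_le _ _).trans (natDegree_mul_le.trans ?_)
      rw [natDegree_X, hdeg, add_comm]
    · exact (natDegree_C_mul_le _ _).trans
        ((natDegree_conjReflect_le hdeg.le).trans (Nat.le_succ _))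
  have hS0 : S ≠ 0 := fun h => hc (by rw [← hcoeff, h, coeff_zero])
  have hW0 : W ≠ 0 := fun h => hS0 (by rw [hW, h, mul_zero])
  have hfac : ((X - C a) * (1 - C (star a) * X)).natDegree = 2 := by
    have h1 : (1 - C (star a) * X : ℂ[X]) = C (-star a) * X + C 1 := by simp; ring
    have h2 : (C (-star a) * X + C 1 : ℂ[X]).natDegree = 1 :=
      natDegree_linear (neg_ne_zero.2 (star_ne_zero.2 ha))
    rw [h1, natDegree_mul (X_sub_C_ne_zero a)
      (fun h => by rw [h, natDegree_zero] at h2; omega), h2, natDegree_X_sub_C]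
  have hWdeg : W.degree < size n := by
    rw [← natDegree_lt_iff_degree_lt hW0]
    have h1 := congrArg natDegree hW
    rw [natDegree_mul (fun h => by rw [h, natDegree_zero] at hfac; omega) hW0, hfac] at h1
    omega
  refine hW0 (hρ a W hWdeg ?_)
  have hcomb := horth.add_mul horth.star (continuous_hexp_mul_eval _ _)
    (continuous_hexp_mul_eval _ _).star (exists_norm_hexp_mul_eval_le _ _)
    (by simpa only [norm_star] using exists_norm_hexp_mul_eval_le _ _) c (star c)
  convert hcomb using 2 with θ
  set z := hexp 2 θ with hz
  have hzz : star z * z = 1 := by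
    rw [hz, star_hexp, ← hexp_add]
    exact hexp_zero θ
  have hz0 : z ≠ 0 := hexp_ne_zero 2 θ
  have hzinv : (star z)⁻¹ = z :=
    inv_eq_of_mul_eq_one_right hzz
  -- on the circle the divisor of degree two equals `z |z - a|²`
  have heval : (z - a) * (1 - star a * z) * W.eval z =
      c * (z * P.eval z) + star c * (z ^ size n * star (P.eval z)) := by
    have h1 := congrArg (eval z) hW
    rw [hS] at h1
    simp only [eval_add, eval_mul, eval_C, eval_X, eval_sub, eval_one,
      eval_conjReflect hdeg.le hz0, hzinv] at h1
    exact h1.symm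
  have hnorm : ((‖z - a‖ ^ 2 : ℝ) : ℂ) = (z - a) * (star z - star a) := by
    rw [← star_sub, Complex.star_def, Complex.mul_conj, Complex.normSq_eq_norm_sq]
  have h3 : hexp (1 - size n) θ * z ^ size n = hexp (size n + 1) θ := by
    rw [hz, hexp_pow, ← hexp_add]
    congr 1
    ring
  have h4 : hexp (size n + 1) θ * star z = hexp (size n - 1) θ := by
    rw [hz, star_hexp, ← hexp_add]
    congr 1
    ring
  rw [star_mul', star_hexp, hnorm, neg_sub, ← h4, ← h3]
  linear_combination hexp (1 - size n) θ * star z * heval +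
    (hexp (1 - size n) θ * (z - a) * eval z W * star a + hexp (1 - size n) θ * c * eval z P) * hzz

/-- The zeros of a monic polynomial satisfying the orthogonality relations lie in the unit disc. If
`P` had a zero outside, then `|z P|` and `|P^*|` would agree somewhere in the disc, and for a
suitable `c` the combination `c z P + conj(c) P^*` would have a zero off the circle. A zero on the
circle would be a double zero of such a combination. -/
theorem norm_lt_one_of_isRoot (hρ : IsNondegenerate ρ n) (hP : P.Monic)
    (hdeg : P.natDegree = size n)
    (horth : IsOrthogonal ρ n fun θ => hexp (1 - size n) θ * P.eval (hexp 2 θ))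
    {z : ℂ} (hz : P.IsRoot z) : ‖z‖ < 1 := by
  by_contra! hz1
  have hz0 : z ≠ 0 := fun h => by simp [h] at hz1; linarith
  rcases eq_or_lt_of_le hz1 with hz1 | hz1
  -- a zero on the circle: `c` is chosen so that `z` is a double zero of the combination
  · obtain ⟨Q, hQ⟩ := dvd_iff_isRoot.2 hz
    have hQ0 : Q ≠ 0 := fun h => hP.ne_zero (by rw [hQ, h, mul_zero])
    have hQdeg : 1 + Q.natDegree = size n := by
      rw [← hdeg, hQ, natDegree_mul (X_sub_C_ne_zero z) hQ0, natDegree_X_sub_C]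
    have hzz : z * star z = 1 := by
      rw [Complex.star_def, Complex.mul_conj, Complex.normSq_eq_norm_sq, ← hz1]
      simp
    have hinv : (star z)⁻¹ = z := (eq_inv_of_mul_eq_one_left hzz).symm
    have hPstar : conjReflect (size n) P =
        (1 - C (star z) * X) * conjReflect Q.natDegree Q := by
      rw [conjReflect, hQ, ← hQdeg, Polynomial.map_mul,
        reflect_mul _ _ (natDegree_map_le.trans (natDegree_X_sub_C_le z)) natDegree_map_le]
      congr 1
      simp [reflect_sub, reflect_C]
    obtain ⟨c, hc, hcz⟩ := exists_mul_add_star_mul_eq_zero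
      (A := z * Q.eval z) (B := -star z * (conjReflect Q.natDegree Q).eval z) (by
        rw [eval_conjReflect le_rfl hz0, hinv]
        simp [← hz1])
    refine not_dvd_combination hρ hP hdeg horth hc hz0 ?_
    obtain ⟨W, hW⟩ : X - C z ∣
        C c * (X * Q) - C (star c) * C (star z) * conjReflect Q.natDegree Q := by
      refine dvd_iff_isRoot.2 ?_
      simp only [IsRoot.def, eval_sub, eval_mul, eval_C, eval_X]
      linear_combination hcz
    have hCzz : (C z * C (star z) : ℂ[X]) = 1 := by rw [← C_mul, hzz, C_1]
    refine ⟨-C z * W, ?_⟩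
    rw [hPstar]
    nth_rewrite 1 [hQ]
    linear_combination (X - C z) * hW + (-(C (star c) * conjReflect Q.natDegree Q) -
      (X - C z) * X * W) * hCzz
  -- a zero outside: on the segment from `0` to `1 / conj z`, a zero of `P^*`, the difference
  -- `|w P(w)| - |P^*(w)|` changes sign, since `P^*(0) = 1`
  · have hh : ∃ s ∈ Set.Icc (0 : ℝ) 1,
        ‖(conjReflect (size n) P).eval (s * (star z)⁻¹)‖ =
          ‖(s * (star z)⁻¹) * P.eval (s * (star z)⁻¹)‖ := by
      have hcont : ContinuousOn (fun s : ℝ =>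
          ‖(s * (star z)⁻¹) * P.eval (s * (star z)⁻¹)‖ -
          ‖(conjReflect (size n) P).eval (s * (star z)⁻¹)‖) (Set.Icc 0 1) := by
        fun_prop
      have hmem : (0 : ℝ) ∈ Set.Icc (‖((0 : ℝ) * (star z)⁻¹) * P.eval ((0 : ℝ) * (star z)⁻¹)‖ -
          ‖(conjReflect (size n) P).eval ((0 : ℝ) * (star z)⁻¹)‖)
          (‖((1 : ℝ) * (star z)⁻¹) * P.eval ((1 : ℝ) * (star z)⁻¹)‖ -
          ‖(conjReflect (size n) P).eval ((1 : ℝ) * (star z)⁻¹)‖) := by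
        constructor
        · simp
        · rw [eval_conjReflect hdeg.le (by simpa using hz0)]
          simp [hz.eq_zero]
          positivity
      obtain ⟨s, hs, hs0⟩ := intermediate_value_Icc zero_le_one hcont hmem
      exact ⟨s, hs, (sub_eq_zero.1 hs0).symm⟩
    obtain ⟨s, hs, hs1⟩ := hh
    set a : ℂ := s * (star z)⁻¹ with ha
    have ha0 : a ≠ 0 := by
      intro h
      have h2 : P.coeff (size n) = 1 := by rw [← hdeg]; exact hP
      rw [h, ← coeff_zero_eq_eval_zero, coeff_conjReflect] at hs1
      simp [h2] at hs1
    have ha1 : ‖a‖ < 1 := by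
      rw [ha, norm_mul, norm_inv, norm_star, Complex.norm_real, Real.norm_of_nonneg hs.1]
      have := inv_lt_one_of_one_lt₀ hz1
      have h3 : 0 < ‖z‖⁻¹ := by positivity
      nlinarith [hs.2]
    obtain ⟨c, hc, hca⟩ := exists_mul_add_star_mul_eq_zero hs1.symm
    refine not_dvd_combination hρ hP hdeg horth hc ha0 ?_
    set u : ℂ := (star a)⁻¹ with hu
    have hu0 : u ≠ 0 := inv_ne_zero (star_ne_zero.2 ha0)
    have hau : star a * u = 1 := mul_inv_cancel₀ (star_ne_zero.2 ha0)
    have hua : (star u)⁻¹ = a := by rw [hu, star_inv₀, star_star, inv_inv]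
    have hne : a ≠ u := by
      intro h
      rw [← h] at hau
      have := congrArg norm hau
      rw [norm_mul, norm_star, norm_one] at this
      nlinarith [norm_nonneg a]
    have hroot : ∀ w, c * (w * P.eval w) + star c * (conjReflect (size n) P).eval w = 0 →
        X - C w ∣ C c * (X * P) + C (star c) * conjReflect (size n) P := fun w hw => by
      refine dvd_iff_isRoot.2 ?_
      simpa only [IsRoot.def, eval_add, eval_mul, eval_C, eval_X] using hw
    -- the combination is self-reciprocal, so that `1 / conj a` is a zero along with `a`
    have hu' : c * (u * P.eval u) + star c * (conjReflect (size n) P).eval u = 0 := by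
      rw [eval_conjReflect hdeg.le ha0] at hca
      rw [eval_conjReflect hdeg.le hu0, hua]
      have h1 := congrArg star hca
      simp only [star_add, star_mul', star_star, star_pow, star_zero] at h1
      have h2 : star a ^ size n * u ^ size n = 1 := by rw [← mul_pow, hau, one_pow]
      linear_combination u ^ (size n + 1) * h1 - c * u * P.eval u * h2 -
        star c * star (P.eval a) * u ^ size n * hau
    obtain ⟨W, hW⟩ := (isCoprime_X_sub_C_of_isUnit_sub (sub_ne_zero.2 hne).isUnit).mul_dvd
      (hroot a hca) (hroot u hu')
    have hCau : (C (star a) * C u : ℂ[X]) = 1 := by rw [← C_mul, hau, C_1]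
    refine ⟨-C u * W, ?_⟩
    rw [hW]
    linear_combination -(X - C a) * X * W * hCau

end

/-! ### The angle as a coordinate on the circle -/

lemma argFrom_mem_Ico (t : ℝ) (z : ℂ) : argFrom t z ∈ Set.Ico t (t + 2 * Real.pi) :=
  toIcoMod_mem_Ico _ _ _

lemma norm_mul_hexp_two_argFrom (t : ℝ) (z : ℂ) : ‖z‖ * hexp 2 (argFrom t z) = z := by
  have h : hexp 2 (argFrom t z) = Complex.exp (Complex.arg z * Complex.I) := by
    rw [hexp_two, argFrom, toIcoMod, Complex.exp_eq_exp_iff_exists_int]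
    refine ⟨-toIcoDiv Real.two_pi_pos t (Complex.arg z), ?_⟩
    push_cast
    simp
    ring
  rw [h, Complex.norm_mul_exp_arg_mul_I]

lemma hexp_two_argFrom (t : ℝ) {z : ℂ} (hz : ‖z‖ = 1) : hexp 2 (argFrom t z) = z := by
  simpa [hz] using norm_mul_hexp_two_argFrom t z

lemma argFrom_hexp_two {t θ : ℝ} (hθ : θ ∈ Set.Ico t (t + 2 * Real.pi)) :
    argFrom t (hexp 2 θ) = θ :=
  hexp_two_injOn t (argFrom_mem_Ico t _) hθ (hexp_two_argFrom t (norm_hexp 2 θ))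

lemma halfPow_eq_hexp (t : ℝ) (k : ℤ) {z : ℂ} (hz : ‖z‖ = 1) :
    halfPow t k z = hexp k (argFrom t z) := by
  simp [halfPow, hexp, hz]

lemma halfPow_mul_halfPow (t : ℝ) (N k : ℕ) {z : ℂ} (hz : z ≠ 0) :
    halfPow t N z * halfPow t (2 * (k : ℤ) - N) z = z ^ k := by
  have h1 : ‖z‖ ^ ((N : ℤ) / 2 : ℝ) * ‖z‖ ^ (((2 * (k : ℤ) - N : ℤ) : ℝ) / 2) = ‖z‖ ^ k := by
    rw [← Real.rpow_add (norm_pos_iff.2 hz), ← Real.rpow_natCast]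
    congr 1
    push_cast
    ring
  have h2 : ∀ s, halfPow t s z = ((‖z‖ ^ ((s : ℝ) / 2) : ℝ) : ℂ) * hexp s (argFrom t z) :=
    fun s => rfl
  rw [h2, h2, mul_mul_mul_comm, ← Complex.ofReal_mul, ← hexp_add, h1,
    show (N : ℤ) + (2 * (k : ℤ) - N) = k * 2 by ring, ← hexp_pow, Complex.ofReal_pow, ← mul_pow,
    norm_mul_hexp_two_argFrom]

lemma measurable_argFrom (t : ℝ) : Measurable (argFrom t) := by
  unfold argFrom toIcoMod
  simp_rw [toIcoDiv_eq_floor]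
  fun_prop

/-- Away from the ray at angle `t` the argument is a rotation of the principal argument. -/
lemma continuousAt_argFrom {t : ℝ} {z : ℂ} (hz : z ≠ 0) (ht : argFrom t z ≠ t) :
    ContinuousAt (argFrom t) z := by
  set u : ℂ → ℂ := fun w => w * hexp 2 (-(t + Real.pi)) with hu
  have hhexp : ∀ x y : ℝ, hexp 2 (x + y) = hexp 2 x * hexp 2 y := fun x y => by
    rw [hexp_two, hexp_two, hexp_two, ← Complex.exp_add]
    congr 1
    push_cast
    ring
  have hexpI : ∀ x : ℝ, hexp 2 x = Complex.cos x + Complex.sin x * Complex.I := fun x => by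
    rw [hexp_two, mul_comm, Complex.exp_mul_I]
  have huc : Continuous u := by fun_prop
  have hslit : u z ∈ Complex.slitPlane := by
    have h1 : u z = ‖z‖ * hexp 2 (argFrom t z - (t + Real.pi)) := by
      simp only [hu]
      nth_rewrite 1 [← norm_mul_hexp_two_argFrom t z]
      rw [mul_assoc, ← hhexp, ← sub_eq_add_neg]
    have h2 := argFrom_mem_Ico t z
    have h3 : t < argFrom t z := lt_of_le_of_ne h2.1 (Ne.symm ht)
    have h4 : Complex.arg (u z) = argFrom t z - (t + Real.pi) := by
      rw [h1, hexpI]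
      exact Complex.arg_mul_cos_add_sin_mul_I (norm_pos_iff.2 hz)
        ⟨by linarith, by linarith [h2.2]⟩
    rw [Complex.mem_slitPlane_iff_arg, h4]
    refine ⟨by linarith [h2.2], mul_ne_zero hz (hexp_ne_zero _ _)⟩
  have hev : (fun w => t + Real.pi + Complex.arg (u w)) =ᶠ[nhds z] argFrom t := by
    filter_upwards [huc.continuousAt (Complex.isOpen_slitPlane.mem_nhds hslit)] with w hw
    have hw' := Complex.mem_slitPlane_iff_arg.1 hw
    have hw0 : w ≠ 0 := fun h => hw'.2 (by simp [hu, h])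
    refine hexp_two_injOn t ⟨?_, ?_⟩ (argFrom_mem_Ico t w) ?_
    · linarith [Complex.neg_pi_lt_arg (u w)]
    · linarith [lt_of_le_of_ne (Complex.arg_le_pi (u w)) hw'.1]
    · have h1 : (‖w‖ : ℂ) ≠ 0 := by exact_mod_cast norm_ne_zero_iff.2 hw0
      refine mul_left_cancel₀ h1 ?_
      rw [norm_mul_hexp_two_argFrom, hhexp, mul_left_comm]
      have h2 : ‖u w‖ = ‖w‖ := by simp [hu, norm_hexp]
      have h3 := Complex.norm_mul_exp_arg_mul_I (u w)
      rw [h2, mul_comm (Complex.arg (u w) : ℂ), ← hexp_two] at h3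
      rw [h3, hu, mul_left_comm, ← hhexp]
      simp [hexp]
  exact (continuousAt_const.add ((Complex.continuousAt_arg hslit).comp huc.continuousAt)).congr hev

lemma exists_of_mem_circleArc {a b : ℝ} {z : ℂ} (hz : z ∈ circleArc a b) :
    ∃ θ ∈ Set.Icc a b, hexp 2 θ = z := by
  obtain ⟨θ, hθ, rfl⟩ := hz
  exact ⟨θ, hθ, hexp_two θ⟩

lemma norm_eq_one_of_mem_circleArc {a b : ℝ} {z : ℂ} (hz : z ∈ circleArc a b) : ‖z‖ = 1 := by
  obtain ⟨θ, -, rfl⟩ := exists_of_mem_circleArc hz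
  exact norm_hexp 2 θ

/-- The angle of a point of an arc lies in the interval of the arc, unless the interval ends at
`t + 2π` and the point is the endpoint, whose angle is `t`. -/
lemma argFrom_mem_Icc_or {t a b : ℝ} (ha : t ≤ a) (hb : b ≤ t + 2 * Real.pi) {z : ℂ}
    (hz : z ∈ circleArc a b) :
    argFrom t z ∈ Set.Icc a b ∨
      b = t + 2 * Real.pi ∧ z = Complex.exp (Complex.I * t) ∧ argFrom t z = t := by
  obtain ⟨θ, hθ, rfl⟩ := exists_of_mem_circleArc hz
  rcases lt_or_ge θ (t + 2 * Real.pi) with h | h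
  · left
    rwa [argFrom_hexp_two ⟨ha.trans hθ.1, h⟩]
  · right
    have h1 : θ = t + 2 * Real.pi := le_antisymm (hθ.2.trans hb) h
    have h2 : hexp 2 θ = hexp 2 t := by
      rw [h1, hexp_two, hexp_two, Complex.exp_eq_exp_iff_exists_int]
      exact ⟨1, by push_cast; ring⟩
    refine ⟨le_antisymm hb (h.trans hθ.2), by rw [h2, hexp_two], ?_⟩
    rw [h2, argFrom_hexp_two ⟨le_rfl, by linarith [Real.pi_pos]⟩]

lemma infinite_support_map_argFrom {t a b : ℝ} (ha : t ≤ a) (hb : b ≤ t + 2 * Real.pi)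
    {μ : Measure ℂ} (hμ : μ.support.Infinite) (hsub : μ.support ⊆ circleArc a b) :
    ((μ.map (argFrom t)).support ∩ Set.Ioo a b).Infinite := by
  -- the endpoints are removed, so that the angle is continuous at the remaining points
  have hinf := hμ.sdiff (Set.toFinite {hexp 2 a, hexp 2 b})
  have hinj : Set.InjOn (argFrom t) (μ.support \ {hexp 2 a, hexp 2 b}) := by
    intro z hz w hw h
    rw [← hexp_two_argFrom t (norm_eq_one_of_mem_circleArc (hsub hz.1)), h,
      hexp_two_argFrom t (norm_eq_one_of_mem_circleArc (hsub hw.1))]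
  refine (hinf.image hinj).mono ?_
  rintro _ ⟨z, ⟨hz, hzab⟩, rfl⟩
  obtain ⟨θ, hθ, rfl⟩ := exists_of_mem_circleArc (hsub hz)
  have hθ' : θ ∈ Set.Ioo a b :=
    ⟨lt_of_le_of_ne hθ.1 fun h => hzab (by simp [h]),
      lt_of_le_of_ne hθ.2 fun h => hzab (by simp [h])⟩
  have harg : argFrom t (hexp 2 θ) = θ :=
    argFrom_hexp_two ⟨ha.trans hθ.1, hθ'.2.trans_le hb⟩
  refine ⟨?_, by rwa [harg]⟩
  rw [Measure.mem_support_iff_forall]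
  intro U hU
  have hc : ContinuousAt (argFrom t) (hexp 2 θ) :=
    continuousAt_argFrom (hexp_ne_zero 2 θ) (by rw [harg]; exact (ha.trans_lt hθ'.1).ne')
  exact ((Measure.mem_support_iff_forall _).1 hz _ (hc hU)).trans_le
    (Measure.le_map_apply (measurable_argFrom t).aemeasurable U)

/-! ### Existence and uniqueness -/

/-- A square system of linear equations: uniqueness of its solutions is nondegeneracy. -/
lemma existsUnique_monic_isOrthogonal {r : ℕ} {ρ : Fin r → Measure ℝ} {n : Fin r → ℕ}
    [∀ j, IsFiniteMeasure (ρ j)] (hρ : IsNondegenerate ρ n) :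
    ∃! P : ℂ[X], (P.Monic ∧ P.natDegree = size n) ∧
      IsOrthogonal ρ n fun θ => hexp (1 - size n) θ * P.eval (hexp 2 θ) := by
  have hint : ∀ (P : ℂ[X]) (j : Fin r) (s : ℤ),
      Integrable (fun θ => hexp (1 - size n) θ * P.eval (hexp 2 θ) * hexp s θ) (ρ j) :=
    fun P j s => integrable_mul_hexp _ (continuous_hexp_mul_eval _ _)
      (exists_norm_hexp_mul_eval_le _ _) _
  let L : ℂ[X] →ₗ[ℂ] ((Σ j : Fin r, Fin (n j)) → ℂ) :=
    { toFun := fun P i => ∫ θ, hexp (1 - size n) θ * P.eval (hexp 2 θ) *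
        hexp (2 * (i.2 : ℤ) + 1 - n i.1) θ ∂ρ i.1
      map_add' := fun P Q => by
        ext i
        rw [Pi.add_apply, ← integral_add (hint P _ _) (hint Q _ _)]
        simp only [eval_add, mul_add, add_mul]
      map_smul' := fun c P => by
        ext i
        rw [Pi.smul_apply, smul_eq_mul, RingHom.id_apply, ← integral_const_mul]
        congr 1
        ext θ
        rw [eval_smul, smul_eq_mul]
        ring }
  have hL : ∀ P, L P = 0 ↔
      IsOrthogonal ρ n fun θ => hexp (1 - size n) θ * P.eval (hexp 2 θ) := fun P =>
    ⟨fun h j k => congrFun h ⟨j, k⟩, fun h => funext fun i => h i.1 i.2⟩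
  have hzero : ∀ W : ℂ[X], W.degree < size n → L W = 0 → W = 0 := by
    intro W hW h
    -- for `a = 0` the weight `|z - a|²` is one on the circle
    refine hρ 0 W hW ?_
    simpa [norm_hexp] using (hL W).1 h
  let L' := L.comp (degreeLT ℂ (size n)).subtype
  have hinj : Function.Injective L' := by
    rw [← LinearMap.ker_eq_bot, LinearMap.ker_eq_bot']
    rintro ⟨W, hW⟩ h
    exact Subtype.ext (hzero W (mem_degreeLT.1 hW) h)
  have hfin : FiniteDimensional ℂ (degreeLT ℂ (size n)) :=
    (degreeLTEquiv ℂ (size n)).symm.finiteDimensional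
  have hrank : Module.finrank ℂ (degreeLT ℂ (size n)) =
      Module.finrank ℂ ((Σ j : Fin r, Fin (n j)) → ℂ) := by
    rw [(degreeLTEquiv ℂ (size n)).finrank_eq, Module.finrank_fintype_fun_eq_card,
      Module.finrank_fintype_fun_eq_card, Fintype.card_sigma, Fintype.card_fin]
    simp [size]
  obtain ⟨⟨Q, hQ⟩, hQL⟩ :=
    (LinearMap.injective_iff_surjective_of_finrank_eq_finrank hrank).1 hinj (-L (X ^ size n))
  have hQ' := mem_degreeLT.1 hQ
  have hQL' : L Q = -L (X ^ size n) := hQL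
  refine ⟨X ^ size n + Q, ⟨⟨monic_X_pow_add hQ', ?_⟩, (hL _).1 ?_⟩, ?_⟩
  · exact natDegree_eq_of_degree_eq_some (by
      rw [degree_add_eq_left_of_degree_lt (by rwa [degree_X_pow]), degree_X_pow])
  · rw [map_add, hQL', add_neg_cancel]
  · rintro P ⟨⟨hP, hPdeg⟩, hPo⟩
    refine sub_eq_zero.1 (hzero _ ?_ ?_)
    · have h1 : P.degree = (X ^ size n + Q).degree := by
        rw [degree_add_eq_left_of_degree_lt (by rwa [degree_X_pow]), degree_X_pow,
          degree_eq_natDegree hP.ne_zero, hPdeg]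
      have h2 := degree_sub_lt_left h1 hP.ne_zero (by rw [hP, monic_X_pow_add hQ'])
      rwa [degree_eq_natDegree hP.ne_zero, hPdeg] at h2
    · rw [map_sub, (hL P).2 hPo, map_add, hQL', add_neg_cancel, sub_zero]

/-- The Laurent polynomial `z^{-N/2} P(z)`. It is written out as a sum, so that it has a value at
`z = 0`. -/
noncomputable def toLaurent (t : ℝ) (N : ℕ) (P : ℂ[X]) (z : ℂ) : ℂ :=
  ∑ k ∈ Finset.range (N + 1), P.coeff k * halfPow t (2 * (k : ℤ) - N) z

lemma halfPow_mul_toLaurent (t : ℝ) {N : ℕ} {P : ℂ[X]} (hP : P.natDegree ≤ N) {z : ℂ}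
    (hz : z ≠ 0) : halfPow t N z * toLaurent t N P z = P.eval z := by
  rw [toLaurent, Finset.mul_sum, eval_eq_sum_range' (Nat.lt_succ_of_le hP)]
  refine Finset.sum_congr rfl fun k _ => ?_
  rw [mul_left_comm, halfPow_mul_halfPow t N k hz]

lemma isMonicTypeII_iff {r : ℕ} {t : ℝ} {μ : Fin r → Measure ℂ} {n : Fin r → ℕ}
    (hμ : ∀ j, ∀ᵐ z ∂μ j, ‖z‖ = 1) {φ : ℂ → ℂ} :
    IsMonicTypeII t μ n φ ↔ ∃ P : ℂ[X], ((P.Monic ∧ P.natDegree = size n) ∧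
      IsOrthogonal (fun j => (μ j).map (argFrom t)) n
        fun θ => hexp (1 - size n) θ * P.eval (hexp 2 θ)) ∧ φ = toLaurent t (size n) P := by
  have horth : ∀ P : ℂ[X], P.natDegree ≤ size n →
      ((∀ (j : Fin r) (k : Fin (n j)),
        ∫ z, toLaurent t (size n) P z * halfPow t ((n j : ℤ) - 2 * (k : ℤ)) z ∂(μ j) = 0) ↔
      IsOrthogonal (fun j => (μ j).map (argFrom t)) n
        fun θ => hexp (1 - size n) θ * P.eval (hexp 2 θ)) := by
    intro P hP
    refine forall_congr' fun j => ?_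
    -- the two families of exponents are enumerated in opposite directions
    rw [← Fin.revPerm.forall_congr_right]
    refine forall_congr' fun k => Eq.congr ?_ rfl
    refine Eq.trans ?_ (integral_map (measurable_argFrom t).aemeasurable
      ((continuous_hexp_mul_eval _ _).mul (continuous_hexp _)).aestronglyMeasurable).symm
    refine integral_congr_ae ?_
    filter_upwards [hμ j] with z hz
    have hz0 : z ≠ 0 := fun h => by simp [h] at hz
    have h1 := halfPow_mul_toLaurent t hP hz0
    have h2 : ((Fin.revPerm k : Fin (n j)) : ℤ) = n j - 1 - k := by
      rw [Fin.revPerm_apply, Fin.val_rev]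
      have := k.2
      omega
    rw [Pi.mul_apply, h2, hexp_two_argFrom t hz, ← h1, halfPow_eq_hexp t _ hz,
      halfPow_eq_hexp t _ hz,
      show (n j : ℤ) - 2 * (n j - 1 - k) = (1 - size n) + size n + (2 * (k : ℤ) + 1 - n j) by ring,
      hexp_add, hexp_add]
    ring
  constructor
  · rintro ⟨⟨κ, hκ⟩, ho⟩
    set Q : ℂ[X] := ∑ k : Fin (size n), C (κ k) * X ^ (k : ℕ) with hQ
    have hQdeg : Q.degree < size n := by
      refine (degree_sum_le _ _).trans_lt ((Finset.sup_lt_iff (WithBot.bot_lt_coe _)).2 ?_)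
      exact fun k _ => (degree_C_mul_X_pow_le _ _).trans_lt (by exact_mod_cast k.2)
    have hdeg : (X ^ size n + Q).natDegree = size n :=
      natDegree_eq_of_degree_eq_some (by
        rw [degree_add_eq_left_of_degree_lt (by rwa [degree_X_pow]), degree_X_pow])
    have hφ : φ = toLaurent t (size n) (X ^ size n + Q) := by
      ext z
      rw [hκ, toLaurent, Finset.sum_range_succ, Finset.sum_range, add_comm]
      congr 1
      · refine Finset.sum_congr rfl fun k _ => ?_
        congr 1
        simp [hQ, coeff_X_pow, k.2.ne, Fin.val_inj]
      · rw [coeff_add, coeff_eq_zero_of_degree_lt hQdeg, coeff_X_pow_self, add_zero, one_mul]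
        congr 1
        ring
    refine ⟨_, ⟨⟨monic_X_pow_add hQdeg, hdeg⟩, (horth _ hdeg.le).1 ?_⟩, hφ⟩
    rwa [← hφ]
  · rintro ⟨P, ⟨⟨hP, hdeg⟩, ho⟩, rfl⟩
    refine ⟨⟨fun k => P.coeff k, fun z => ?_⟩, (horth P hdeg.le).2 ho⟩
    have hlead : P.coeff (size n) = 1 := by rw [← hdeg]; exact hP
    rw [toLaurent, Finset.sum_range_succ, hlead, Finset.sum_range, add_comm, one_mul]
    congr 2
    ring

/-- Nondegeneracy of the angular measures gives normality and the location of zeros. -/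
theorem isPhiNormal_and_roots_of_isNondegenerate {r : ℕ} {t : ℝ} {μ : Fin r → Measure ℂ}
    {n : Fin r → ℕ} [∀ j, IsFiniteMeasure (μ j)] (hμ : ∀ j, ∀ᵐ z ∂μ j, ‖z‖ = 1)
    (hρ : IsNondegenerate (fun j => (μ j).map (argFrom t)) n) :
    IsPhiNormal t μ n ∧ ∀ φ : ℂ → ℂ, IsMonicTypeII t μ n φ →
      ∃ P : ℂ[X], (∀ z : ℂ, z ≠ 0 → P.eval z = halfPow t (size n) z * φ z) ∧
        P.roots.card = size n ∧ ∀ z ∈ P.roots, z ∈ Metric.ball (0 : ℂ) 1 := by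
  have hfin : ∀ j, IsFiniteMeasure ((μ j).map (argFrom t)) := fun j => inferInstance
  constructor
  · obtain ⟨P, hP, huniq⟩ := existsUnique_monic_isOrthogonal hρ
    refine ⟨toLaurent t (size n) P, (isMonicTypeII_iff hμ).2 ⟨P, hP, rfl⟩, fun φ hφ => ?_⟩
    obtain ⟨Q, hQ, rfl⟩ := (isMonicTypeII_iff hμ).1 hφ
    rw [huniq Q hQ]
  · intro φ hφ
    obtain ⟨P, ⟨⟨hP, hdeg⟩, ho⟩, rfl⟩ := (isMonicTypeII_iff hμ).1 hφ
    refine ⟨P, fun z hz => (halfPow_mul_toLaurent t hdeg.le hz).symm, ?_, fun z hz => ?_⟩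
    · rw [← hdeg]
      exact (splits_iff_card_roots.1 (IsAlgClosed.splits P))
    · rw [mem_ball_zero_iff]
      exact norm_lt_one_of_isRoot hρ hP hdeg ho (isRoot_of_mem_roots hz)

/-! ### Angelesco systems -/

/-- The enumeration of the orthogonality relations of the index `n`, block after block. -/
def sizeEquiv {r : ℕ} (n : Fin r → ℕ) : (Σ j : Fin r, Fin (n j)) ≃ Fin (size n) :=
  finSigmaFinEquiv

/-- For exponentials, the block determinant is the product of the determinants of the blocks. -/
lemma blockDet_sigma {r : ℕ} (n : Fin r → ℕ) (x : Fin (size n) → ℝ) :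
    blockDet (fun i : Fin (size n) => ((sizeEquiv n).symm i).1)
      (fun i => hexp (2 * (((sizeEquiv n).symm i).2 : ℤ) + 1 -
        n ((sizeEquiv n).symm i).1)) x =
    ∏ j, hexpDet (n j) fun k => x (sizeEquiv n ⟨j, k⟩) := by
  rw [blockDet, ← Matrix.det_submatrix_equiv_self (sizeEquiv n),
    Matrix.BlockTriangular.det_fintype (b := Sigma.fst)]
  · refine Finset.prod_congr rfl fun j _ => ?_
    rw [hexpDet, ← Matrix.det_submatrix_equiv_self (Equiv.sigmaSubtype j).symm]
    congr 1
    ext l k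
    simp [Matrix.toSquareBlock, Matrix.toSquareBlockProp, Equiv.sigmaSubtype]
    rw [Equiv.symm_apply_apply]
  · intro p q hpq
    simp [hpq.ne']

lemma setOf_mem_Ioo_and_norm_hexp_sub_eq_zero_finite (t : ℝ) (a : ℂ) :
    {θ | θ ∈ Set.Ioo t (t + 2 * Real.pi) ∧ ‖hexp 2 θ - a‖ ^ 2 = 0}.Finite := by
  refine Set.Subsingleton.finite fun x hx y hy => ?_
  refine hexp_two_injOn t (Set.Ioo_subset_Ico_self hx.1) (Set.Ioo_subset_Ico_self hy.1) ?_
  have h1 := hx.2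
  have h2 := hy.2
  rw [pow_eq_zero_iff two_ne_zero, norm_eq_zero, sub_eq_zero] at h1 h2
  rw [h1, h2]

/-- The blocks are the measures of the system, and each block contributes the Vandermonde
determinant of its own exponentials. -/
theorem IsAngelescoSystem.isNondegenerate {r : ℕ} {t : ℝ} {μ : Fin r → Measure ℂ}
    [∀ j, IsFiniteMeasure (μ j)] (hinf : ∀ j, (μ j).support.Infinite)
    (hμ : IsAngelescoSystem t μ) (n : Fin r → ℕ) :
    IsNondegenerate (fun j => (μ j).map (argFrom t)) n := by
  obtain ⟨a, b, hab, hsep, hsub, hend⟩ := hμ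
  intro z W hW ho
  refine eq_zero_of_forall_integral_eq_zero
    (fun i : Fin (size n) => ((sizeEquiv n).symm i).1) (fun j => (μ j).map (argFrom t)) t a b
    (fun j => ⟨(hab j).1, (hab j).2.2⟩) (fun j k hjk => ?_) (fun j => ?_)
    (fun i => infinite_support_map_argFrom (hab _).1 (hab _).2.2 (hinf _) (hsub _))
    (fun i => hexp (2 * (((sizeEquiv n).symm i).2 : ℤ) + 1 - n ((sizeEquiv n).symm i).1))
    (fun i => (continuous_hexp _).continuousOn) ?_ (fun x hx hxI => ?_)
    (fun θ => ‖hexp 2 θ - z‖ ^ 2) (((continuous_hexp 2).sub continuous_const).norm.pow 2)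
    (fun θ => by positivity) (setOf_mem_Ioo_and_norm_hexp_sub_eq_zero_finite t z) W hW
    (fun i => ho _ _)
  · refine Set.disjoint_left.2 fun θ h1 h2 => ?_
    rcases hsep j k hjk with h | h
    · linarith [h1.2, h2.1]
    · linarith [h1.1, h2.2]
  · refine (ae_map_iff (measurable_argFrom t).aemeasurable measurableSet_Icc).2 ?_
    have hnull : ∀ᵐ w ∂μ j, b j = t + 2 * Real.pi → w ≠ Complex.exp (Complex.I * t) := by
      by_cases hb : b j = t + 2 * Real.pi
      · have := hend j hb
        filter_upwards [measure_eq_zero_iff_ae_notMem.1 this] with w hw _ using hw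
      · exact Filter.Eventually.of_forall fun w h => absurd h hb
    filter_upwards [(μ j).support_mem_ae, hnull] with w hw hw'
    rcases argFrom_mem_Icc_or (hab j).1 (hab j).2.2 (hsub j hw) with h | ⟨h1, h2, -⟩
    · exact h
    · exact absurd h2 (hw' h1)
  · choose c hc hreal using exists_mul_hexpDet_real
    refine ⟨∏ j, c (n j), Finset.prod_ne_zero_iff.2 fun j _ => hc _, fun x => ?_⟩
    rw [blockDet_sigma, ← Finset.prod_mul_distrib]
    have : ∀ j, c (n j) * hexpDet (n j) (fun k => x (sizeEquiv n ⟨j, k⟩)) =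
        ((c (n j) * hexpDet (n j) fun k => x (sizeEquiv n ⟨j, k⟩)).re : ℂ) := fun j => by
      apply Complex.ext
      · simp
      · rw [hreal, Complex.ofReal_im]
    rw [Finset.prod_congr rfl fun j _ => this j, ← Complex.ofReal_prod, Complex.ofReal_im]
  · rw [blockDet_sigma]
    refine Finset.prod_ne_zero_iff.2 fun j _ => hexpDet_ne_zero_iff.2 fun k l hkl => ?_
    have hmem : ∀ i, x i ∈ Set.Ico t (t + 2 * Real.pi) := fun i =>
      ⟨(hab _).1.trans (hxI i).1.le, (hxI i).2.trans_le (hab _).2.2⟩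
    have := (sizeEquiv n).injective (hx (hexp_two_injOn t (hmem _) (hmem _) hkl))
    simpa using this

/-! ### AT systems -/

/-- The members of `Trig_m(f)` are combinations of `f` times exponentials. -/
lemma exists_trigFamily_eq (m : ℕ) (k : Fin m) : ∃ (k₁ k₂ : Fin m) (c₁ c₂ : ℂ),
    ∀ (f : ℝ → ℝ) (θ : ℝ), (trigFamily m f k θ : ℂ) =
      f θ * (c₁ * hexp (2 * (k₁ : ℤ) + 1 - m) θ + c₂ * hexp (2 * (k₂ : ℤ) + 1 - m) θ) := by
  -- an exponential of frequency `s / 2` and its conjugate occur if `s < m` and `m - s` is odd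
  have key : ∀ s : ℕ, s < m → Odd (m - s) → ∃ (k₁ k₂ : Fin m),
      2 * (k₁ : ℤ) + 1 - m = s ∧ 2 * (k₂ : ℤ) + 1 - m = -s := by
    rintro s hs ⟨d, hd⟩
    exact ⟨⟨m - 1 - d, by omega⟩, ⟨d, by omega⟩, by simp only; omega, by simp only; omega⟩
  have hcos : ∀ (s : ℕ) (θ : ℝ), ((Real.cos ((s : ℝ) / 2 * θ) : ℝ) : ℂ) =
      1 / 2 * hexp s θ + 1 / 2 * hexp (-s) θ := by
    intro s θ
    rw [Complex.ofReal_cos, Complex.cos, hexp, hexp]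
    push_cast
    have h1 : -((s : ℂ) / 2 * θ) * Complex.I = Complex.I * (-s) * θ / 2 := by ring
    have h2 : (s : ℂ) / 2 * θ * Complex.I = Complex.I * s * θ / 2 := by ring
    rw [h1, h2]
    ring
  have hsin : ∀ (s : ℕ) (θ : ℝ), ((Real.sin ((s : ℝ) / 2 * θ) : ℝ) : ℂ) =
      -Complex.I / 2 * hexp s θ + Complex.I / 2 * hexp (-s) θ := by
    intro s θ
    rw [Complex.ofReal_sin, Complex.sin, hexp, hexp]
    push_cast
    have h1 : -((s : ℂ) / 2 * θ) * Complex.I = Complex.I * (-s) * θ / 2 := by ring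
    have h2 : (s : ℂ) / 2 * θ * Complex.I = Complex.I * s * θ / 2 := by ring
    rw [h1, h2]
    ring
  have hk := k.2
  unfold trigFamily
  by_cases hm : Even m
  · by_cases hk2 : Even (k : ℕ)
    · obtain ⟨k₁, k₂, h₁, h₂⟩ := key (k + 1) (by grind) (by grind)
      refine ⟨k₁, k₂, 1 / 2, 1 / 2, fun f θ => ?_⟩
      rw [if_pos hm, if_pos hk2, h₁, h₂, ← hcos]
      push_cast
      rfl
    · obtain ⟨k₁, k₂, h₁, h₂⟩ := key k (by grind) (by grind)
      refine ⟨k₁, k₂, -Complex.I / 2, Complex.I / 2, fun f θ => ?_⟩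
      rw [if_pos hm, if_neg hk2, h₁, h₂, ← hsin]
      push_cast
      rfl
  · by_cases hk2 : Even (k : ℕ)
    · obtain ⟨k₁, k₂, h₁, h₂⟩ := key k (by grind) (by grind)
      refine ⟨k₁, k₂, 1 / 2, 1 / 2, fun f θ => ?_⟩
      rw [if_neg hm, if_pos hk2, h₁, h₂, ← hcos]
      push_cast
      rfl
    · obtain ⟨k₁, k₂, h₁, h₂⟩ := key (k + 1) (by grind) (by grind)
      refine ⟨k₁, k₂, -Complex.I / 2, Complex.I / 2, fun f θ => ?_⟩
      rw [if_neg hm, if_neg hk2, h₁, h₂, ← hsin]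
      push_cast
      rfl

lemma integral_map_argFrom_withDensity {t : ℝ} {μ ν : Measure ℂ} {w : ℝ → ℝ} (hw : Measurable w)
    (hw0 : ∀ᵐ z ∂ν, 0 ≤ w (argFrom t z))
    (hμ : μ = ν.withDensity fun z => ENNReal.ofReal (w (argFrom t z)))
    {g : ℝ → ℂ} (hg : Continuous g) :
    ∫ θ, g θ ∂μ.map (argFrom t) = ∫ θ, g θ * w θ ∂ν.map (argFrom t) := by
  have ht := measurable_argFrom t
  have hwt : Measurable fun z => ENNReal.ofReal (w (argFrom t z)) := (hw.comp ht).ennreal_ofReal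
  have hgw : Measurable fun θ => g θ * w θ :=
    hg.measurable.mul (Complex.measurable_ofReal.comp hw)
  rw [integral_map ht.aemeasurable hg.aestronglyMeasurable,
    integral_map ht.aemeasurable hgw.aestronglyMeasurable, hμ,
    integral_withDensity_eq_integral_toReal_smul hwt
      (Filter.Eventually.of_forall fun _ => ENNReal.ofReal_lt_top)]
  refine integral_congr_ae ?_
  filter_upwards [hw0] with z hz
  rw [ENNReal.toReal_ofReal hz, Complex.real_smul, mul_comm]

/-- There is a single block, with the reference measure `ν`, and the block determinant is that of
the Chebyshev system. The relations are rewritten from exponentials to the functions of the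
system. -/
theorem IsATSystem.isNondegenerate {r : ℕ} {α β : ℝ} {μ : Fin r → Measure ℂ} {n : Fin r → ℕ}
    [∀ j, IsFiniteMeasure (μ j)] (hinf : ∀ j, (μ j).support.Infinite)
    (hμ : IsATSystem α β μ n) : IsNondegenerate (fun j => (μ j).map (argFrom α)) n := by
  obtain ⟨hpos, hlen, ν, w, hνfin, hsub, hw, hw0, hdens, hcont, hcheb⟩ := hμ
  intro z W hW ho
  have hlen' : β ≤ α + 2 * Real.pi := by linarith
  have hG : Continuous fun θ => ‖hexp 2 θ - z‖ ^ 2 :=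
    ((continuous_hexp 2).sub continuous_const).norm.pow 2
  set e : (Σ j : Fin r, Fin (n j)) ≃ Fin (size n) := sizeEquiv n
  set u : (Σ j : Fin r, Fin (n j)) → ℝ → ℝ :=
    fun i => trigFamily (n i.1) (w i.1) i.2 with hu
  have hdet : ∀ (_ : DecidableEq Unit) (x : Fin (size n) → ℝ),
      blockDet (fun _ => ()) (fun i θ => ((u (e.symm i) θ : ℝ) : ℂ)) x =
        (((Matrix.of fun i k => u i (x (e k))).det : ℝ) : ℂ) := by
    intro _ x
    rw [blockDet, ← Matrix.det_submatrix_equiv_self e, ← Complex.ofRealHom_eq_coe,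
      RingHom.map_det]
    congr 1
    ext i k
    simp
  refine eq_zero_of_forall_integral_eq_zero
    (fun _ : Fin (size n) => ()) (fun _ => ν.map (argFrom α)) α (fun _ => α) (fun _ => β)
    (fun _ => ⟨le_rfl, hlen'⟩) (fun j k hjk => absurd rfl hjk) (fun _ => ?_) (fun i => ?_)
    (fun i θ => ((u (e.symm i) θ : ℝ) : ℂ))
    (fun i => Complex.continuous_ofReal.comp_continuousOn (hcont _))
    ⟨1, one_ne_zero, fun x => by rw [one_mul, hdet, Complex.ofReal_im]⟩ (fun x hx hxI => ?_)
    (fun θ => ‖hexp 2 θ - z‖ ^ 2) hG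
    (fun θ => by positivity) (setOf_mem_Ioo_and_norm_hexp_sub_eq_zero_finite α z) W hW
    (fun i => ?_)
  · refine (ae_map_iff (measurable_argFrom α).aemeasurable measurableSet_Icc).2 ?_
    filter_upwards [ν.support_mem_ae] with y hy
    rcases argFrom_mem_Icc_or le_rfl hlen' (hsub hy) with h | ⟨-, -, h⟩
    · exact h
    · rw [h]
      exact ⟨le_rfl, by linarith⟩
  · refine infinite_support_map_argFrom le_rfl hlen' ?_ hsub
    refine (hinf (e.symm i).1).mono (Measure.AbsolutelyContinuous.support_mono ?_)
    rw [hdens]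
    exact withDensity_absolutelyContinuous _ _
  · rw [hdet, Complex.ofReal_ne_zero]
    exact hcheb _ (fun i => Set.Ioo_subset_Icc_self (hxI _)) (hx.comp e.injective)
  · obtain ⟨j, k⟩ := e.symm i
    obtain ⟨k₁, k₂, c₁, c₂, hk⟩ := exists_trigFamily_eq (n j) k
    set f : ℝ → ℂ := fun θ =>
      hexp (1 - size n) θ * W.eval (hexp 2 θ) * ((‖hexp 2 θ - z‖ ^ 2 : ℝ) : ℂ) with hf
    have hfc : Continuous f :=
      (continuous_hexp_mul_eval _ _).mul (Complex.continuous_ofReal.comp hG)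
    have hfb : ∃ C, ∀ θ, ‖f θ‖ ≤ C := by
      obtain ⟨C, hC⟩ := exists_norm_hexp_mul_eval_le (1 - size n) W
      refine ⟨C * (1 + ‖z‖) ^ 2, fun θ => ?_⟩
      rw [hf, norm_mul, Complex.norm_real, norm_pow, norm_norm]
      have h1 : ‖hexp 2 θ - z‖ ≤ 1 + ‖z‖ := by
        simpa only [norm_hexp] using norm_sub_le (hexp 2 θ) z
      have h2 := (norm_nonneg _).trans (hC θ)
      exact mul_le_mul (hC θ) (pow_le_pow_left₀ (norm_nonneg _) h1 2) (by positivity) h2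
    have hint := fun s => integrable_mul_hexp ((μ j).map (argFrom α)) hfc hfb s
    have hsum : ∫ θ, c₁ * (f θ * hexp (2 * (k₁ : ℤ) + 1 - n j) θ) +
        c₂ * (f θ * hexp (2 * (k₂ : ℤ) + 1 - n j) θ) ∂(μ j).map (argFrom α) = 0 := by
      rw [integral_add ((hint _).const_mul _) ((hint _).const_mul _), integral_const_mul,
        integral_const_mul, ho j k₁, ho j k₂]
      simp
    have hcont₂ : Continuous fun θ => c₁ * (f θ * hexp (2 * (k₁ : ℤ) + 1 - n j) θ) +
        c₂ * (f θ * hexp (2 * (k₂ : ℤ) + 1 - n j) θ) :=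
      (continuous_const.mul (hfc.mul (continuous_hexp _))).add
        (continuous_const.mul (hfc.mul (continuous_hexp _)))
    rw [integral_map_argFrom_withDensity (hw j) (hw0 j) (hdens j) hcont₂] at hsum
    rw [← hsum]
    congr 1
    ext θ
    simp only [hu, hk]
    ring

end LaurentMOPUC

theorem mainTheorem1 {r : ℕ} (μ : Fin r → Measure ℂ) (hfin : ∀ j, IsFiniteMeasure (μ j))
    (hinf : ∀ j, (μ j).support.Infinite) (n : Fin r → ℕ) (t₀ : ℝ)
    (hμ : LaurentMOPUC.IsAngelescoSystem t₀ μ ∨ ∃ β : ℝ, LaurentMOPUC.IsATSystem t₀ β μ n) :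
    LaurentMOPUC.IsPhiNormal t₀ μ n ∧
    ∀ φ : ℂ → ℂ, LaurentMOPUC.IsMonicTypeII t₀ μ n φ →
      ∃ P : ℂ[X],
        (∀ z : ℂ, z ≠ 0 → P.eval z =
          LaurentMOPUC.halfPow t₀ (LaurentMOPUC.size n) z * φ z) ∧
        P.roots.card = LaurentMOPUC.size n ∧
        ∀ z ∈ P.roots, z ∈ Metric.ball (0 : ℂ) 1 := by
  have hcircle : ∀ j, ∀ᵐ z ∂μ j, ‖z‖ = 1 := by
    intro j
    rcases hμ with ⟨a, b, -, -, hsub, -⟩ | ⟨β, -, -, ν, w, -, hsub, -, -, hdens, -⟩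
    · filter_upwards [(μ j).support_mem_ae] with z hz
      exact LaurentMOPUC.norm_eq_one_of_mem_circleArc (hsub j hz)
    · have hac : μ j ≪ ν := by
        rw [hdens]
        exact withDensity_absolutelyContinuous _ _
      filter_upwards [hac.ae_le ν.support_mem_ae] with z hz
      exact LaurentMOPUC.norm_eq_one_of_mem_circleArc (hsub hz)
  refine LaurentMOPUC.isPhiNormal_and_roots_of_isNondegenerate hcircle ?_
  rcases hμ with hμ | ⟨β, hμ⟩
  · exact hμ.isNondegenerate hinf n
  · exact hμ.isNondegenerate hinf
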